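/- Let $n\ge 0$ and let $G=(V,E)$ be a finite graph (finite vertex and edge sets; self-loops and multiple edges are allowed), regarded as a topological space, namely as a one-dimensional CW complex. A continuous map $\phi\colon G\to\mathbb R^n$ is called rectifiable if $G$ is covered by the images of finitely many paths $\gamma\colon[0,1]\to G$ for which $\phi\circ\gamma$ has finite length, and it is called an immersion if it is locally an embedding, i.e. every point of $G$ has a neighbourhood on which $\phi$ restricts to a homeomorphism onto its image. For continuous rectifiable maps $\phi,\psi\colon G\to\mathbb R^n$ let $$d_{FG}(\phi,\psi)=\inf_{h}\ \sup_{x\in G}\|\phi(x)-\psi(h(x))\|_2 ,$$ where $h$ ranges over all homeomorphisms $h\colon G\to G$. Then $d_{FG}$ is a pseudometric; identify two continuous rectifiable maps $\phi,\psi$ when $d_{FG}(\phi,\psi)=0$, and let $\mathcal I(G)$ be the metric space, with distance $d_{FG}$, of all equivalence classes that contain an immersion. Then for every class $c\in\mathcal I(G)$ and every real $r>0$, the open ball $\{c'\in\mathcal I(G): d_{FG}(c,c')<r\}$ is path-connected (as a subspace of $\mathcal I(G)$): any two of its points are joined by a continuous path $[0,1]\to\mathcal I(G)$ that stays in the ball.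 -/

import Mathlib

open Topology Set
open scoped ENNReal NNReal unitInterval

universe u v

/-- A multigraph with vertex set `V` and edge set `E`; self-loops and multiple edges are allowed.
Each edge carries an (auxiliary) order of its two endpoints, used only to attach its 1-cell. -/
structure Multigraph (V : Type u) (E : Type v) where
  src : E → V
  tgt : E → V

namespace Multigraph

variable {V : Type u} {E : Type v}

/-- The disjoint union of the vertices and of one copy of `[0,1]` for each edge. -/
def Cells (_G : Multigraph V E) : Type (max u v) := V ⊕ (E × I)

/-- The disjoint union topology: vertices and edges are discrete, `[0,1]` has its usual topology. -/
instance (G : Multigraph V E) : TopologicalSpace G.Cells :=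
  letI : TopologicalSpace V := ⊥
  letI : TopologicalSpace E := ⊥
  inferInstanceAs (TopologicalSpace (V ⊕ (E × I)))

/-- The gluing relation: the two ends of each edge are attached to its endpoints. -/
inductive Glue (G : Multigraph V E) : G.Cells → G.Cells → Prop
  | src (e : E) : Glue G (Sum.inr (e, 0)) (Sum.inl (G.src e))
  | tgt (e : E) : Glue G (Sum.inr (e, 1)) (Sum.inl (G.tgt e))

/-- The graph as a topological space (a one-dimensional CW complex): the quotient of the disjoint
union of cells by the equivalence relation generated by `Glue`, with the quotient topology. -/
def Space (G : Multigraph V E) : Type (max u v) := Quot G.Glue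

instance (G : Multigraph V E) : TopologicalSpace G.Space :=
  inferInstanceAs (TopologicalSpace (Quot G.Glue))

end Multigraph

section Maps

variable {X : Type*} [TopologicalSpace X] {n : ℕ}

/-- A continuous map `φ : X → ℝⁿ` is rectifiable if `X` is covered by the images of finitely many
paths in `X` whose compositions with `φ` have finite length. (`BoundedVariationOn f univ` says that
the supremum of the lengths of inscribed polygons is finite.) -/
def IsRectifiableMap (φ : C(X, EuclideanSpace ℝ (Fin n))) : Prop :=
  ∃ S : Set C(I, X), S.Finite ∧ (⋃ γ ∈ S, range γ) = univ ∧
    ∀ γ ∈ S, BoundedVariationOn (fun t : I => φ (γ t)) univ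

/-- A map is a (topological) immersion if it is locally an embedding. -/
def IsTopImmersion (φ : X → EuclideanSpace ℝ (Fin n)) : Prop :=
  ∀ x : X, ∃ U ∈ 𝓝 x, IsEmbedding (U.domRestrict φ)

/-- The Fréchet distance of `φ : X → ℝⁿ` and `ψ : Y → ℝⁿ`: the infimum over all homeomorphisms
`h : X → Y` of `‖φ - ψ ∘ h‖_∞`; it is `∞` if there is no such `h`. -/
noncomputable def frechetEDist {Y : Type*} [TopologicalSpace Y]
    (φ : X → EuclideanSpace ℝ (Fin n)) (ψ : Y → EuclideanSpace ℝ (Fin n)) : ℝ≥0∞ :=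
  ⨅ h : X ≃ₜ Y, ⨆ x : X, edist (φ x) (ψ (h x))

end Maps

/-- The continuous rectifiable maps `X → ℝⁿ`, before passing to equivalence classes. -/
structure RectMap (X : Type*) [TopologicalSpace X] (n : ℕ) where
  toMap : C(X, EuclideanSpace ℝ (Fin n))
  rectifiable : IsRectifiableMap toMap

namespace RectMap

variable {X : Type*} [TopologicalSpace X] {n : ℕ}

/-- The extended pseudometric (and the open ball topology) given by the Fréchet distance. -/
noncomputable instance : PseudoEMetricSpace (RectMap X n) where
  edist φ ψ := frechetEDist φ.toMap ψ.toMap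
  edist_self φ := by
    refine le_antisymm (iInf_le_of_le (Homeomorph.refl X) ?_) zero_le
    simp
  edist_comm := by
    have key : ∀ φ ψ : RectMap X n,
        frechetEDist φ.toMap ψ.toMap ≤ frechetEDist ψ.toMap φ.toMap := by
      intro φ ψ
      refine le_iInf fun h => iInf_le_of_le h.symm (iSup_le fun x => ?_)
      refine le_trans (le_of_eq ?_)
        (le_iSup (fun y => edist (ψ.toMap y) (φ.toMap (h y))) (h.symm x))
      simp [edist_comm]
    exact fun φ ψ => le_antisymm (key φ ψ) (key ψ φ)
  edist_triangle φ ψ χ := by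
    unfold frechetEDist
    rw [ENNReal.iInf_add]
    refine le_iInf fun h => ?_
    rw [ENNReal.add_iInf]
    refine le_iInf fun k => iInf_le_of_le (h.trans k) (iSup_le fun x => ?_)
    refine (edist_triangle _ (ψ.toMap (h x)) _).trans (add_le_add ?_ ?_)
    · exact le_iSup (fun y => edist (φ.toMap y) (ψ.toMap (h y))) x
    · exact le_iSup (fun y => edist (ψ.toMap y) (χ.toMap (k y))) (h x)

end RectMap

/-- The space of equivalence classes of continuous rectifiable maps `G → ℝⁿ`, two maps being
equivalent if and only if their Fréchet distance is `0`, with the induced extended metric. -/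
abbrev ContMapSpace {V : Type u} {E : Type v} (G : Multigraph V E) (n : ℕ) :=
  SeparationQuotient (RectMap G.Space n)

/-- Two maps define the same class exactly when their Fréchet distance vanishes. -/
theorem ContMapSpace.mk_eq_mk_iff {V : Type u} {E : Type v} {G : Multigraph V E} {n : ℕ}
    (φ ψ : RectMap G.Space n) :
    (SeparationQuotient.mk φ : ContMapSpace G n) = SeparationQuotient.mk ψ ↔
      frechetEDist φ.toMap ψ.toMap = 0 :=
  SeparationQuotient.mk_eq_mk.trans EMetric.inseparable_iff

/-- The classes that are represented by an immersion. -/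
def immersionClasses {V : Type u} {E : Type v} (G : Multigraph V E) (n : ℕ) :
    Set (ContMapSpace G n) :=
  {c | ∃ φ : RectMap G.Space n, IsTopImmersion φ.toMap ∧ SeparationQuotient.mk φ = c}

/-- The extended metric space of classes of immersions `G → ℝⁿ` under the Fréchet distance,
a subspace of `ContMapSpace G n`. -/
abbrev ImmersionSpace {V : Type u} {E : Type v} (G : Multigraph V E) (n : ℕ) :=
  ↥(immersionClasses G n)

/-! Let `φ` be an immersion representing the centre of the ball and `ψ` one representing another
point of it. Some homeomorphism `h` makes `ψ ∘ h⁻¹` uniformly closer than `r` to `φ`, and `ψ ∘ h⁻¹`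
represents the same class. It therefore suffices to join two uniformly close rectifiable immersions,
up to a homeomorphism at the end, by a uniformly continuous family of rectifiable immersions within
distance `r` of the first (`exists_path_rectifiable_immersion`). In dimension 0 there is only one
map.

In dimension 1, a locally injective real function is injective on each connected component, so its
image there is a compact interval or a point. Composing `φ` with one increasing affine map per
component matches the images of `ψ`, after which the two maps differ by a homeomorphism. The
straight homotopy to the modified map has positive slope over `φ` on every component, so it stays an
immersion, and the affine displacement is extremal at interval ends, where it is below `r`
(`exists_path_immersion_line`).

In dimension at least 2, the straight homotopy from `φ` to `ψ` need be neither immersed nor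
rectifiable in between. At scale `δ = η t (1 - t)` both maps are replaced by moving averages, whose
Lipschitz constant is of order `1/δ`, and on each edge a planar closed curve of size `O(δ)` and
speed about `K/δ` is added. For `K` large the added velocity dominates, which gives local
injectivity inside edges. At the vertices the added curves leave in pairwise different directions,
which separates the half-edges. As `δ → 0` the perturbation vanishes uniformly, so the ends are `φ`
and `ψ` themselves and a small `η` keeps the path in the ball (`exists_path_immersion`). -/

namespace Multigraph

/-! ### Topology of the graph: compactness, separation, local connectedness, basic neighbourhoods.
-/

variable {V : Type u} {E : Type v} (G : Multigraph V E)

/-- The point of the graph given by a vertex. -/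
def vtx (v : V) : G.Space := Quot.mk _ (Sum.inl v)

/-- The point of the graph with parameter `s` on the edge `e`. -/
def pt (e : E) (s : I) : G.Space := Quot.mk _ (Sum.inr (e, s))

theorem pt_zero (e : E) : G.pt e 0 = G.vtx (G.src e) := Quot.sound (.src e)

theorem pt_one (e : E) : G.pt e 1 = G.vtx (G.tgt e) := Quot.sound (.tgt e)

variable {G}

/-- Functions on the graph from functions on its cells. -/
def lift {Y : Type*} (g : V → Y) (f : E → I → Y) (h0 : ∀ e, f e 0 = g (G.src e))
    (h1 : ∀ e, f e 1 = g (G.tgt e)) : G.Space → Y :=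
  Quot.lift (Sum.elim g fun p => f p.1 p.2) (by
    rintro _ _ (e | e)
    · exact h0 e
    · exact h1 e)

variable (G) in
theorem continuous_pt (e : E) : Continuous (G.pt e) := by
  let : TopologicalSpace V := ⊥
  let : TopologicalSpace E := ⊥
  have h1 : Continuous (Quot.mk G.Glue) := continuous_quot_mk
  have h2 : Continuous (fun s : I => (Sum.inr (e, s) : V ⊕ (E × I))) :=
    continuous_inr.comp (Continuous.prodMk continuous_const continuous_id)
  exact h1.comp h2

theorem continuous_iff {Y : Type*} [TopologicalSpace Y] {F : G.Space → Y} :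
    Continuous F ↔ ∀ e, Continuous fun s => F (G.pt e s) := by
  refine ⟨fun h e => h.comp (G.continuous_pt e), fun h => ?_⟩
  let : TopologicalSpace V := ⊥
  let : TopologicalSpace E := ⊥
  have : DiscreteTopology V := ⟨rfl⟩
  have : DiscreteTopology E := ⟨rfl⟩
  have hq : IsQuotientMap (Quot.mk G.Glue) := isQuotientMap_quot_mk
  refine hq.continuous_iff.2 ?_
  change Continuous (fun x : V ⊕ (E × I) => F (Quot.mk G.Glue x))
  refine continuous_sum_dom.2 ⟨continuous_of_discreteTopology, ?_⟩
  exact continuous_prod_of_discrete_left.2 h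

theorem exists_vtx_or_pt (x : G.Space) :
    (∃ v, x = G.vtx v) ∨ ∃ e, ∃ s : I, 0 < (s : ℝ) ∧ (s : ℝ) < 1 ∧ x = G.pt e s := by
  induction x using Quot.ind with
  | mk c =>
    rcases c with v | ⟨e, s⟩
    · exact .inl ⟨v, rfl⟩
    · rcases s.2.1.eq_or_lt with h | h
      · have : s = 0 := Subtype.ext h.symm
        subst this
        exact .inl ⟨_, G.pt_zero e⟩
      · rcases s.2.2.eq_or_lt with h' | h'
        · have : s = 1 := Subtype.ext h'
          subst this
          exact .inl ⟨_, G.pt_one e⟩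
        · exact .inr ⟨e, s, h, h', rfl⟩

instance [Finite V] [Finite E] : CompactSpace G.Space := by
  refine ⟨?_⟩
  have : (univ : Set G.Space) = range G.vtx ∪ ⋃ e, range (G.pt e) := by
    refine (eq_univ_of_forall fun x => ?_).symm
    rcases exists_vtx_or_pt x with ⟨v, rfl⟩ | ⟨e, s, -, -, rfl⟩
    · exact .inl ⟨v, rfl⟩
    · exact .inr (mem_iUnion.2 ⟨e, s, rfl⟩)
  rw [this]
  exact (finite_range _).isCompact.union (isCompact_iUnion fun e => isCompact_range (G.continuous_pt e))

instance : LocallyConnectedSpace G.Space := by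
  let : TopologicalSpace V := ⊥
  let : TopologicalSpace E := ⊥
  have : DiscreteTopology V := ⟨rfl⟩
  have : DiscreteTopology E := ⟨rfl⟩
  have : LocallyPathConnectedSpace I :=
    (isQuotientMap_projIcc (a := (0 : ℝ)) (b := 1) (h := zero_le_one)).locallyPathConnectedSpace
  have hq : IsQuotientMap (Quot.mk G.Glue) := isQuotientMap_quot_mk
  have : LocallyPathConnectedSpace (V ⊕ (E × I)) := inferInstance
  have : LocallyConnectedSpace G.Cells := by
    change LocallyConnectedSpace (V ⊕ (E × I))
    infer_instance
  exact hq.isCoinducing.locallyConnectedSpace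

open Classical in
/-- The function that is `1` at the vertex `v` and decreases linearly along the half-edges at `v`. -/
noncomputable def hat (v : V) : G.Space → ℝ :=
  lift (fun w => if w = v then 1 else 0)
    (fun e s => max (if G.src e = v then 1 - (s : ℝ) else 0) (if G.tgt e = v then (s : ℝ) else 0))
    (fun e => by by_cases h : G.src e = v <;> by_cases h' : G.tgt e = v <;> simp [h, h'])
    (fun e => by by_cases h : G.src e = v <;> by_cases h' : G.tgt e = v <;> simp [h, h'])

open Classical in
/-- A function on `[0,1]` vanishing at both ends, as a function supported on the edge `e`. -/
noncomputable def bump (e : E) (f : ℝ → ℝ) (h0 : f 0 = 0) (h1 : f 1 = 0) : G.Space → ℝ :=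
  lift (fun _ => 0) (fun e' s => if e' = e then f s else 0)
    (fun e' => by simp [h0]) (fun e' => by simp [h1])

open Classical in
theorem hat_vtx (v w : V) : hat (G := G) v (G.vtx w) = if w = v then 1 else 0 := rfl

open Classical in
theorem hat_pt (v : V) (e : E) (s : I) : hat (G := G) v (G.pt e s) =
    max (if G.src e = v then 1 - (s : ℝ) else 0) (if G.tgt e = v then (s : ℝ) else 0) := rfl

open Classical in
theorem bump_pt (e : E) (f : ℝ → ℝ) (h0 : f 0 = 0) (h1 : f 1 = 0) (e' : E) (s : I) :
    bump (G := G) e f h0 h1 (G.pt e' s) = if e' = e then f s else 0 := rfl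

theorem bump_vtx (e : E) (f : ℝ → ℝ) (h0 : f 0 = 0) (h1 : f 1 = 0) (v : V) :
    bump (G := G) e f h0 h1 (G.vtx v) = 0 := rfl

theorem continuous_hat (v : V) : Continuous (hat (G := G) v) := by
  classical
  refine continuous_iff.2 fun e => ?_
  simp only [hat_pt]
  refine Continuous.max ?_ ?_ <;> split_ifs <;> fun_prop

theorem continuous_bump (e : E) {f : ℝ → ℝ} (h0 : f 0 = 0) (h1 : f 1 = 0) (hf : Continuous f) :
    Continuous (bump (G := G) e f h0 h1) := by
  classical
  refine continuous_iff.2 fun e => ?_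
  simp only [bump_pt]
  split_ifs <;> fun_prop

/-- The tent-like function `s (1 - s)` on the edge `e`. -/
noncomputable def tent (e : E) : G.Space → ℝ := bump e (fun s => s * (1 - s)) (by simp) (by simp)

/-- The function `s ^ 2 (1 - s)` on the edge `e`. -/
noncomputable def skewTent (e : E) : G.Space → ℝ :=
  bump e (fun s => s * (s * (1 - s))) (by simp) (by simp)

theorem continuous_tent (e : E) : Continuous (tent (G := G) e) := continuous_bump _ _ _ (by fun_prop)

theorem continuous_skewTent (e : E) : Continuous (skewTent (G := G) e) :=
  continuous_bump _ _ _ (by fun_prop)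

/-- Positivity of `tent e` detects the open edge `e`, and the quotient `skewTent e / tent e`
recovers the parameter there. -/
theorem eq_pt_of_tent_pos {e : E} {x : G.Space} (h : 0 < tent e x) :
    ∃ s : I, 0 < (s : ℝ) ∧ (s : ℝ) < 1 ∧ x = G.pt e s ∧
      tent e x = s * (1 - s) ∧ skewTent e x = s * tent e x := by
  rcases exists_vtx_or_pt x with ⟨v, rfl⟩ | ⟨e', s, h0, h1, rfl⟩
  · simp [tent, bump_vtx] at h
  · rw [tent, bump_pt] at h
    split_ifs at h with he
    · subst he
      exact ⟨s, h0, h1, rfl, by simp [tent, bump_pt], by simp [skewTent, tent, bump_pt]⟩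
    · exact absurd h (lt_irrefl _)

theorem tent_pt_pos (e : E) {s : I} (h0 : 0 < (s : ℝ)) (h1 : (s : ℝ) < 1) :
    0 < tent e (G.pt e s) := by
  simp only [tent, bump_pt, if_true]
  exact mul_pos h0 (by linarith)

/-- These continuous functions separate points, which yields the Hausdorff property: the tents
locate interior points of edges, the hats tell vertices apart. -/
theorem eq_of_tent_eq {x y : G.Space} (hh : ∀ v, hat v x = hat v y) (ht : ∀ e, tent e x = tent e y)
    (hs : ∀ e, skewTent e x = skewTent e y) : x = y := by
  classical
  have key : ∀ {e : E} {s : I}, 0 < (s : ℝ) → (s : ℝ) < 1 → ∀ {x y : G.Space},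
      (∀ e, tent e x = tent e y) → (∀ e, skewTent e x = skewTent e y) → x = G.pt e s → x = y := by
    rintro e s h0 h1 x y ht hs rfl
    have hx := tent_pt_pos (G := G) e h0 h1
    obtain ⟨s1, -, -, e1, -, h1⟩ := eq_pt_of_tent_pos hx
    obtain ⟨s2, -, -, e2, -, h2⟩ := eq_pt_of_tent_pos (ht e ▸ hx)
    rw [← ht e, ← hs e, h1] at h2
    have : s1 = s2 := Subtype.ext (mul_right_cancel₀ hx.ne' h2)
    rw [e1, e2, this]
  rcases exists_vtx_or_pt x with ⟨v, rfl⟩ | ⟨e, s, h0, h1, hx⟩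
  · rcases exists_vtx_or_pt y with ⟨w, rfl⟩ | ⟨e, s, h0, h1, hy⟩
    · have := hh v
      simp only [hat_vtx, if_true] at this
      split_ifs at this with h
      · rw [h]
      · norm_num at this
    · exact (key h0 h1 (fun e => (ht e).symm) (fun e => (hs e).symm) hy).symm
  · exact key h0 h1 ht hs hx

instance : T2Space G.Space := by
  refine T2Space.of_injective_continuous (Y := (V → ℝ) × (E → ℝ) × (E → ℝ))
    (f := fun x => (fun v => hat v x, fun e => tent e x, fun e => skewTent e x)) ?_ ?_
  · intro x y h
    simp only [Prod.mk.injEq] at h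
    exact eq_of_tent_eq (congrFun h.1) (congrFun h.2.1) (congrFun h.2.2)
  · refine .prodMk (continuous_pi continuous_hat) (.prodMk (continuous_pi continuous_tent)
      (continuous_pi continuous_skewTent))

/-- The neighbourhood of radius `ρ` around the point with parameter `s₀` of the edge `e`. -/
theorem exists_nhds_pt (e : E) {s₀ : I} (h0 : 0 < (s₀ : ℝ)) (h1 : (s₀ : ℝ) < 1) {ρ : ℝ}
    (hρ : 0 < ρ) : ∃ U ∈ 𝓝 (G.pt e s₀), ∀ x ∈ U, ∃ s : I, |(s : ℝ) - s₀| < ρ ∧ x = G.pt e s := by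
  -- The condition that the parameter `skewTent e / tent e` lies within `ρ` of `s₀`, with
  -- denominators cleared so that both sides are continuous on the whole graph.
  refine ⟨{x | 0 < tent e x ∧ |skewTent e x - s₀ * tent e x| < ρ * tent e x}, ?_, ?_⟩
  · have ht := continuous_tent (G := G) e
    have hs := continuous_skewTent (G := G) e
    have hp := tent_pt_pos (G := G) e h0 h1
    refine IsOpen.mem_nhds (.inter (isOpen_lt (by fun_prop) ht)
      (isOpen_lt (f := fun x => |skewTent e x - s₀ * tent e x|) (by fun_prop) (by fun_prop))) ⟨hp, ?_⟩
    have : skewTent e (G.pt e s₀) = s₀ * tent e (G.pt e s₀) := by simp [skewTent, tent, bump_pt]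
    simpa [this] using mul_pos hρ hp
  · rintro x ⟨hx, hx'⟩
    obtain ⟨s, -, -, rfl, -, h⟩ := eq_pt_of_tent_pos hx
    refine ⟨s, ?_, rfl⟩
    rw [h, ← sub_mul, abs_mul, abs_of_pos hx] at hx'
    exact lt_of_mul_lt_mul_right hx' hx.le

/-- The half-edges: an edge with the end at which it starts (`false` for the source). -/
def halfPt (G : Multigraph V E) (h : E × Bool) (s : I) : G.Space :=
  G.pt h.1 (if h.2 then σ s else s)

/-- The vertex of a half-edge. -/
def halfVtx (G : Multigraph V E) (h : E × Bool) : V := if h.2 then G.tgt h.1 else G.src h.1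

theorem halfPt_zero (h : E × Bool) : G.halfPt h 0 = G.vtx (G.halfVtx h) := by
  rcases h with ⟨e, _ | _⟩
  · simp [halfPt, halfVtx, pt_zero]
  · simp [halfPt, halfVtx, pt_one]

/-- The star of radius `ρ` around a vertex. -/
theorem exists_nhds_vtx (v : V) {ρ : ℝ} (hρ : 0 < ρ) (hρ1 : ρ ≤ 1) :
    ∃ U ∈ 𝓝 (G.vtx v), ∀ x ∈ U, x = G.vtx v ∨
      ∃ h, G.halfVtx h = v ∧ ∃ s : I, 0 < (s : ℝ) ∧ (s : ℝ) < ρ ∧ x = G.halfPt h s := by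
  classical
  refine ⟨{x | 1 - ρ < hat v x}, ?_, ?_⟩
  · exact (isOpen_lt continuous_const (continuous_hat v)).mem_nhds (by simp [hat_vtx, hρ])
  · intro x hx
    rcases exists_vtx_or_pt x with ⟨w, rfl⟩ | ⟨e, s, h0, h1, rfl⟩
    · left
      simp only [mem_ofPred_eq, hat_vtx] at hx
      split_ifs at hx with h
      · rw [h]
      · linarith
    · right
      rw [mem_ofPred_eq, hat_pt, lt_max_iff] at hx
      rcases hx with hx | hx <;> split_ifs at hx with h
      · exact ⟨(e, false), h, s, h0, by linarith, rfl⟩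
      · linarith
      · exact ⟨(e, true), h, σ s, by simpa using h1, by simp; linarith, by simp [halfPt]⟩
      · linarith

end Multigraph

/-! ### Immersions of compact spaces and locally injective real functions. -/

section LocallyInjective

variable {X Y : Type*} [TopologicalSpace X] [TopologicalSpace Y] {n : ℕ}

/-- A continuous injection on a closed, hence compact, neighbourhood is automatically an embedding,
so only local injectivity has to be checked from here on. -/
theorem isTopImmersion_of_injOn [CompactSpace X] [T2Space X] {φ : X → EuclideanSpace ℝ (Fin n)}
    (hφ : Continuous φ) (h : ∀ x, ∃ U ∈ 𝓝 x, InjOn φ U) : IsTopImmersion φ := by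
  intro x
  obtain ⟨U, hU, hinj⟩ := h x
  obtain ⟨K, hK, hKc, hKU⟩ := exists_mem_nhds_isClosed_subset hU
  have : CompactSpace K := isCompact_iff_compactSpace.1 hKc.isCompact
  refine ⟨K, hK, (Continuous.isClosedEmbedding (hφ.comp continuous_subtype_val) ?_).isEmbedding⟩
  intro a b hab
  exact Subtype.ext (hinj (hKU a.2) (hKU b.2) hab)

theorem IsTopImmersion.exists_injOn {φ : X → EuclideanSpace ℝ (Fin n)} (hφ : IsTopImmersion φ)
    (x : X) : ∃ U ∈ 𝓝 x, InjOn φ U := by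
  obtain ⟨U, hU, h⟩ := hφ x
  exact ⟨U, hU, injOn_iff_injective.2 h.injective⟩

theorem IsTopImmersion.comp_homeomorph [CompactSpace X] [T2Space X]
    {φ : X → EuclideanSpace ℝ (Fin n)} (hφ : IsTopImmersion φ) (hc : Continuous φ) (h : X ≃ₜ X) :
    IsTopImmersion (φ ∘ h) := by
  refine isTopImmersion_of_injOn (hc.comp h.continuous) fun x => ?_
  obtain ⟨U, hU, hi⟩ := hφ.exists_injOn (h x)
  exact ⟨h ⁻¹' U, h.continuous.continuousAt hU, hi.comp h.injective.injOn fun _ hx => hx⟩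

theorem IsRectifiableMap.comp_homeomorph {φ : C(X, EuclideanSpace ℝ (Fin n))}
    (hφ : IsRectifiableMap φ) (h : X ≃ₜ X) : IsRectifiableMap (φ.comp (h : C(X, X))) := by
  obtain ⟨S, hS, hcov, hbv⟩ := hφ
  refine ⟨(fun γ => (h.symm : C(X, X)).comp γ) '' S, hS.image _, ?_, ?_⟩
  · refine eq_univ_of_forall fun x => ?_
    have : h x ∈ ⋃ γ ∈ S, range γ := hcov ▸ mem_univ _
    obtain ⟨γ, hγ, t, ht⟩ := mem_iUnion₂.1 this
    exact mem_iUnion₂.2 ⟨_, mem_image_of_mem _ hγ, t, by simp [ht]⟩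
  · rintro _ ⟨γ, hγ, rfl⟩
    simpa using hbv γ hγ

/-- If a locally injective real function is injective on two compact connected sets that meet, then
it takes equal values on them only at common points. -/
theorem image_inter_of_locally_injective [T2Space X] {f : X → ℝ} (hf : Continuous f)
    (hloc : ∀ x, ∃ U ∈ 𝓝 x, InjOn f U) {A B : Set X} (hA : IsCompact A) (hB : IsCompact B)
    (hAc : IsPreconnected A) (hBc : IsPreconnected B) (hAi : InjOn f A) (hBi : InjOn f B)
    (hAB : (A ∩ B).Nonempty) : f '' A ∩ f '' B ⊆ f '' (A ∩ B) := by
  -- The order of the line enters here: both images are intervals, hence so is their intersection.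
  -- In it, `f '' (A ∩ B)` is nonempty, closed and, by `key`, relatively open, so it is everything.
  have hJ : IsPreconnected (f '' A ∩ f '' B) := by
    have h1 := (hAc.image f hf.continuousOn).ordConnected
    have h2 := (hBc.image f hf.continuousOn).ordConnected
    exact (h1.inter h2).isPreconnected
  have key : ∀ z ∈ A ∩ B, ∃ N, (IsOpen N ∧ N ∩ (f '' A ∩ f '' B) ⊆ f '' (A ∩ B)) ∧ f z ∈ N := by
    intro z hz
    obtain ⟨U, hU, hUi⟩ := hloc z
    obtain ⟨O, hOU, hO, hzO⟩ := mem_nhds_iff.1 hU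
    have aux : ∀ {C : Set X}, InjOn f C → z ∈ C → f z ∉ f '' (C \ O) := by
      rintro C hCi hzC ⟨w, hw, hwz⟩
      exact hw.2 (hCi hw.1 hzC hwz ▸ hzO)
    have aux2 : ∀ {C : Set X}, IsCompact C → IsClosed (f '' (C \ O)) := fun hC =>
      ((hC.diff hO).image hf).isClosed
    -- Values in this open set are attained on `A` and on `B` only inside `O`, where `f` is
    -- injective, so the two preimages coincide.
    refine ⟨(f '' (A \ O))ᶜ ∩ (f '' (B \ O))ᶜ,
      ⟨(aux2 hA).isOpen_compl.inter (aux2 hB).isOpen_compl, ?_⟩, aux hAi hz.1, aux hBi hz.2⟩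
    rintro _ ⟨⟨h1, h2⟩, ⟨a, ha, rfl⟩, ⟨b, hb, hab⟩⟩
    have haO : a ∈ O := by
      by_contra h
      exact h1 ⟨a, ⟨ha, h⟩, rfl⟩
    have hbO : b ∈ O := by
      by_contra h
      exact h2 ⟨b, ⟨hb, h⟩, hab⟩
    have : b = a := hUi (hOU hbO) (hOU haO) hab
    exact ⟨a, ⟨ha, this ▸ hb⟩, rfl⟩
  by_contra hne
  obtain ⟨t, ht, htn⟩ := not_subset.1 hne
  have hclosed : IsClosed (f '' (A ∩ B)) := ((hA.inter hB).image hf).isClosed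
  obtain ⟨p, hp⟩ := hAB
  have hcov : f '' A ∩ f '' B ⊆
      ⋃₀ {N | IsOpen N ∧ N ∩ (f '' A ∩ f '' B) ⊆ f '' (A ∩ B)} ∪ (f '' (A ∩ B))ᶜ := by
    intro y hy
    by_cases hyZ : y ∈ f '' (A ∩ B)
    · obtain ⟨z, hz, rfl⟩ := hyZ
      exact .inl (key z hz)
    · exact .inr hyZ
  obtain ⟨y, hyJ, ⟨N, hN, hyN⟩, hy⟩ := hJ _ _ (isOpen_sUnion fun N hN => hN.1)
    hclosed.isOpen_compl hcov
    ⟨f p, ⟨mem_image_of_mem _ hp.1, mem_image_of_mem _ hp.2⟩, key p hp⟩ ⟨t, ht, htn⟩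
  exact hy (hN.2 ⟨hyN, hyJ⟩)

/-- A locally injective real function on a compact locally connected space is injective on each
connected component. -/
theorem injOn_connectedComponent [CompactSpace X] [T2Space X] [LocallyConnectedSpace X] {f : X → ℝ}
    (hf : Continuous f) (hloc : ∀ x, ∃ U ∈ 𝓝 x, InjOn f U) (x₀ : X) :
    InjOn f (connectedComponent x₀) := by
  -- Gluing two such sets at a common point keeps `f` injective by the preceding lemma, so `R` is
  -- transitive. Its classes are clopen and thus contain whole components.
  let R : X → X → Prop := fun x y =>
    ∃ A : Set X, IsCompact A ∧ IsPreconnected A ∧ InjOn f A ∧ x ∈ A ∧ y ∈ A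
  have trans : ∀ {x y z}, R x y → R y z → R x z := by
    rintro x y z ⟨A, hA, hAc, hAi, hx, hy⟩ ⟨B, hB, hBc, hBi, hy', hz⟩
    have hi := image_inter_of_locally_injective hf hloc hA hB hAc hBc hAi hBi ⟨y, hy, hy'⟩
    refine ⟨A ∪ B, hA.union hB, hAc.union y hy hy' hBc, ?_, .inl hx, .inr hz⟩
    have key : ∀ a ∈ A, ∀ b ∈ B, f a = f b → a = b := by
      intro a ha b hb hab
      obtain ⟨c, hc, hca⟩ := hi ⟨mem_image_of_mem f ha, b, hb, hab.symm⟩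
      rw [← hAi hc.1 ha hca]
      exact hBi hc.2 hb (hca.trans hab)
    rintro a (ha | ha) b (hb | hb) hab
    · exact hAi ha hb hab
    · exact key a ha b hb hab
    · exact (key b hb a ha hab.symm).symm
    · exact hBi ha hb hab
  have symm : ∀ {x y}, R x y → R y x := by
    rintro x y ⟨A, hA, hAc, hAi, hx, hy⟩
    exact ⟨A, hA, hAc, hAi, hy, hx⟩
  have hnhds : ∀ x, ∀ᶠ y in 𝓝 x, R x y := by
    intro x
    obtain ⟨U, hU, hUi⟩ := hloc x
    obtain ⟨K, hK, hKc, hKU⟩ := exists_mem_nhds_isClosed_subset hU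
    obtain ⟨W, hWK, hW, hxW, hWc⟩ :=
      locallyConnectedSpace_iff_subsets_isOpen_isConnected.1 ‹_› x K hK
    filter_upwards [hW.mem_nhds hxW] with y hy
    exact ⟨closure W, isClosed_closure.isCompact, hWc.isPreconnected.closure,
      hUi.mono ((closure_minimal hWK hKc).trans hKU), subset_closure hxW, subset_closure hy⟩
  intro x hx y hy hxy
  have hcl : IsClopen {z | R x z} := by
    constructor
    · refine ⟨isOpen_iff_mem_nhds.2 fun z hz => ?_⟩
      filter_upwards [hnhds z] with w hw hxw
      exact hz (trans hxw (symm hw))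
    · refine isOpen_iff_mem_nhds.2 fun z hz => ?_
      filter_upwards [hnhds z] with w hw
      exact trans hz hw
  have hsub := hcl.connectedComponent_subset (x := x) (hnhds x).self_of_nhds
  rw [← connectedComponent_eq hx] at hsub
  obtain ⟨A, -, -, hAi, hxA, hyA⟩ := hsub hy
  exact hAi hxA hyA hxy

end LocallyInjective

/-! ### Dimension one. -/

section Line

variable {X : Type*} [TopologicalSpace X] [CompactSpace X]

/-- Two real functions that are injective on the connected components, and have the same image on
each of them, differ by a homeomorphism. -/
theorem exists_homeomorph_of_image_eq [T2Space X] {f g : X → ℝ} (hf : Continuous f) (hg : Continuous g)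
    (hfi : ∀ x, InjOn f (connectedComponent x)) (hgi : ∀ x, InjOn g (connectedComponent x))
    (him : ∀ x, f '' connectedComponent x = g '' connectedComponent x) :
    ∃ h : X ≃ₜ X, ∀ x, f x = g (h x) := by
  -- Each function, paired with the component map, embeds `X` into `ConnectedComponents X × ℝ`.
  -- Equal images on components make the two embeddings have the same range, and the homeomorphism
  -- is the transition between them.
  have emb : ∀ {f : X → ℝ}, Continuous f → (∀ x, InjOn f (connectedComponent x)) →
      IsEmbedding (fun x : X => ((x : ConnectedComponents X), f x)) := by
    intro f hf hfi
    refine (Continuous.isClosedEmbedding (ConnectedComponents.continuous_coe.prodMk hf) ?_).isEmbedding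
    intro x y hxy
    simp only [Prod.mk.injEq, ConnectedComponents.coe_eq_coe'] at hxy
    exact hfi y hxy.1 mem_connectedComponent hxy.2
  have sub : ∀ {f g : X → ℝ}, (∀ x, f '' connectedComponent x = g '' connectedComponent x) →
      range (fun x : X => ((x : ConnectedComponents X), f x)) ⊆
        range (fun x : X => ((x : ConnectedComponents X), g x)) := by
    rintro f g him _ ⟨x, rfl⟩
    have : f x ∈ g '' connectedComponent x := him x ▸ mem_image_of_mem f mem_connectedComponent
    obtain ⟨y, hy, hyx⟩ := this
    exact ⟨y, Prod.ext (ConnectedComponents.coe_eq_coe'.2 hy) hyx⟩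
  have hr := (sub him).antisymm (sub fun x => (him x).symm)
  have ef := emb hf hfi
  have eg := emb hg hgi
  let h : X ≃ₜ X := (ef.toHomeomorph.trans (Homeomorph.setCongr hr)).trans eg.toHomeomorph.symm
  refine ⟨h, fun x => ?_⟩
  have h1 : eg.toHomeomorph (h x) = Homeomorph.setCongr hr (ef.toHomeomorph x) := by simp [h]
  have h2 := congrArg (fun z => z.1.2) h1
  exact h2.symm

/-- On each connected component, an increasing affine change of `f` has the same image as `g` and
is as close to `f` as `g` is. -/
theorem exists_affine_image_eq {f g : X → ℝ} (hf : Continuous f) (hg : Continuous g)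
    (hfi : ∀ x, InjOn f (connectedComponent x)) (hgi : ∀ x, InjOn g (connectedComponent x)) {r : ℝ}
    (hr : ∀ x, |f x - g x| < r) (x : X) : ∃ α β : ℝ, 0 < α ∧
      (fun y => α * f y + β) '' connectedComponent x = g '' connectedComponent x ∧
      ∀ y ∈ connectedComponent x, |α * f y + β - f y| < r := by
  have hc : IsCompact (connectedComponent x) := isClosed_connectedComponent.isCompact
  have hne : (connectedComponent x).Nonempty := ⟨x, mem_connectedComponent⟩
  have icc : ∀ {f : X → ℝ}, Continuous f → ∃ a b, a ≤ b ∧ f '' connectedComponent x = Icc a b := by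
    intro f hf
    have h := eq_Icc_of_connected_compact (isConnected_connectedComponent.image f hf.continuousOn)
      (hc.image hf)
    refine ⟨_, _, ?_, h⟩
    rw [← nonempty_Icc, ← h]
    exact hne.image f
  obtain ⟨a, b, hab, hF⟩ := icc hf
  obtain ⟨a', b', hab', hG⟩ := icc hg
  -- Both functions are injective on the component, so one image is a single point exactly when the
  -- other is; hence a positive slope `α` exists.
  have degen : ∀ {f g : X → ℝ} {a b a' b' : ℝ}, InjOn f (connectedComponent x) → a = b → a' ≤ b' →
      f '' connectedComponent x = Icc a b → g '' connectedComponent x = Icc a' b' → a' = b' := by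
    intro f g a b a' b' hfi hab hab' hF hG
    subst hab
    have hs : (connectedComponent x).Subsingleton := by
      intro y hy z hz
      have h1 := hF ▸ mem_image_of_mem f hy
      have h2 := hF ▸ mem_image_of_mem f hz
      rw [Icc_self] at h1 h2
      exact hfi hy hz (h1.trans h2.symm)
    have := hs.image g
    rw [hG] at this
    exact this (left_mem_Icc.2 hab') (right_mem_Icc.2 hab')
  obtain ⟨α, hα, hαe⟩ : ∃ α : ℝ, 0 < α ∧ α * (b - a) = b' - a' := by
    rcases hab.eq_or_lt with h | h
    · refine ⟨1, one_pos, ?_⟩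
      rw [degen (hfi x) h hab' hF hG, h]
      ring
    · rcases hab'.eq_or_lt with h' | h'
      · exact absurd (degen (hgi x) h' hab hG hF) h.ne
      · exact ⟨(b' - a') / (b - a), div_pos (by linarith) (by linarith),
          div_mul_cancel₀ _ (by linarith)⟩
  -- Used in both directions, this shows that corresponding ends of the two intervals differ by less
  -- than `r`.
  have low : ∀ {f g : X → ℝ} {a b a' b' : ℝ}, (∀ x, |f x - g x| < r) → a ≤ b →
      f '' connectedComponent x = Icc a b → g '' connectedComponent x = Icc a' b' →
      a' < a + r ∧ b < b' + r := by
    intro f g a b a' b' hr hab hF hG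
    obtain ⟨y, hy, hya⟩ : a ∈ f '' connectedComponent x := hF ▸ left_mem_Icc.2 hab
    obtain ⟨z, hz, hzb⟩ : b ∈ f '' connectedComponent x := hF ▸ right_mem_Icc.2 hab
    have h1 : g y ∈ Icc a' b' := hG ▸ mem_image_of_mem g hy
    have h2 : g z ∈ Icc a' b' := hG ▸ mem_image_of_mem g hz
    have h3 := abs_lt.1 (hr y)
    have h4 := abs_lt.1 (hr z)
    constructor
    · linarith [h1.1]
    · linarith [h2.2]
  obtain ⟨l1, l2⟩ := low hr hab hF hG
  obtain ⟨l3, l4⟩ := low (fun x => by rw [abs_sub_comm]; exact hr x) hab' hG hF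
  refine ⟨α, a' - α * a, hα, ?_, ?_⟩
  · rw [show (fun y => α * f y + (a' - α * a)) = (fun s => α * s + (a' - α * a)) ∘ f from rfl,
      image_comp, hF, hG]
    ext t
    constructor
    · rintro ⟨s, hs, rfl⟩
      constructor <;> nlinarith [hs.1, hs.2]
    · rintro ⟨h1, h2⟩
      refine ⟨a + (t - a') / α, ⟨?_, ?_⟩, ?_⟩
      · have : 0 ≤ (t - a') / α := div_nonneg (by linarith) hα.le
        linarith
      · have : (t - a') / α ≤ b - a := by
          rw [div_le_iff₀ hα]
          linarith
        linarith
      · field_simp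
        ring
  · intro y hy
    have hy' : f y ∈ Icc a b := hF ▸ mem_image_of_mem f hy
    rw [abs_lt]
    -- The displacement is affine in `f y`, so it lies between its values `a' - a` and `b' - b` at
    -- the ends; the sign of `α - 1` says which is larger.
    rcases le_total 1 α with h | h
    · have h1 : 0 ≤ (α - 1) * (f y - a) := mul_nonneg (by linarith) (by linarith [hy'.1])
      have h2 : 0 ≤ (α - 1) * (b - f y) := mul_nonneg (by linarith) (by linarith [hy'.2])
      constructor <;> linarith
    · have h1 : 0 ≤ (1 - α) * (f y - a) := mul_nonneg (by linarith) (by linarith [hy'.1])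
      have h2 : 0 ≤ (1 - α) * (b - f y) := mul_nonneg (by linarith) (by linarith [hy'.2])
      constructor <;> linarith

/-- Two rectifiable immersions into the line are joined, up to a homeomorphism, by a path of
rectifiable immersions that stays close to the first one. -/
theorem exists_path_immersion_line [T2Space X] [LocallyConnectedSpace X]
    (φ ψ : C(X, EuclideanSpace ℝ (Fin 1)))
    (hφr : IsRectifiableMap φ) (hφ : IsTopImmersion φ) (hψ : IsTopImmersion ψ) {r : ℝ}
    (hr : dist ψ φ < r) : ∃ Γ : I → C(X, EuclideanSpace ℝ (Fin 1)), Continuous Γ ∧ Γ 0 = φ ∧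
      (∃ h : X ≃ₜ X, Γ 1 = ψ.comp (h : C(X, X))) ∧
      ∀ t, IsRectifiableMap (Γ t) ∧ IsTopImmersion (Γ t) ∧ dist (Γ t) φ < r := by
  have hr0 : 0 < r := dist_nonneg.trans_lt hr
  have norm1 : ∀ v : EuclideanSpace ℝ (Fin 1), ‖v‖ = |v 0| := fun v => by
    simp [EuclideanSpace.norm_eq, Real.sqrt_sq_eq_abs]
  have ext1 : ∀ v w : EuclideanSpace ℝ (Fin 1), v 0 = w 0 → v = w := fun v w h => by
    ext i
    rwa [Subsingleton.elim i 0]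
  have inj : ∀ {φ : C(X, EuclideanSpace ℝ (Fin 1))}, IsTopImmersion φ → ∀ x,
      InjOn (fun x => φ x 0) (connectedComponent x) := by
    intro φ hφ x
    refine injOn_connectedComponent (by fun_prop) (fun x => ?_) x
    obtain ⟨U, hU, hi⟩ := hφ.exists_injOn x
    exact ⟨U, hU, fun y hy z hz h => hi hy hz (ext1 _ _ h)⟩
  have hfg : ∀ x, |φ x 0 - ψ x 0| < r := fun x => by
    have := (ContinuousMap.dist_lt_iff hr0).1 hr x
    rwa [dist_comm, dist_eq_norm, norm1] at this
  have hf : Continuous fun x => φ x 0 := by fun_prop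
  have hg : Continuous fun x => ψ x 0 := by fun_prop
  -- The coefficients depend only on the component. The space of components is discrete, so they are
  -- continuous on `X`.
  choose α β hα him hd using
    fun c : ConnectedComponents X => exists_affine_image_eq hf hg (inj hφ) (inj hψ) hfg c.out
  have hout : ∀ x : X, connectedComponent (x : ConnectedComponents X).out = connectedComponent x :=
    fun x => ConnectedComponents.coe_eq_coe.1 (Quotient.out_eq _)
  have hcα : Continuous fun x : X => α x :=
    (continuous_of_discreteTopology (f := α)).comp ConnectedComponents.continuous_coe
  have hcβ : Continuous fun x : X => β x :=
    (continuous_of_discreteTopology (f := β)).comp ConnectedComponents.continuous_coe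
  let e : EuclideanSpace ℝ (Fin 1) := EuclideanSpace.single 0 1
  let χ : C(X, EuclideanSpace ℝ (Fin 1)) := ⟨fun x => α x • φ x + β x • e,
    (hcα.smul φ.continuous).add (hcβ.smul continuous_const)⟩
  have hχ : ∀ x, χ x 0 = α x * φ x 0 + β x := fun x => by simp [χ, e]
  have hcc : ∀ {x y : X}, y ∈ connectedComponent x →
      (y : ConnectedComponents X) = (x : ConnectedComponents X) :=
    fun h => ConnectedComponents.coe_eq_coe'.2 h
  have hχd : dist χ φ < r := by
    refine (ContinuousMap.dist_lt_iff hr0).2 fun x => ?_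
    rw [dist_eq_norm, norm1, PiLp.sub_apply, hχ]
    exact hd x x (by rw [hout]; exact mem_connectedComponent)
  have hχi : ∀ x, InjOn (fun x => χ x 0) (connectedComponent x) := by
    intro x y hy z hz h
    simp only [hχ, hcc hy, hcc hz] at h
    exact inj hφ x hy hz (mul_left_cancel₀ (hα x).ne' (add_right_cancel h))
  obtain ⟨h, hh⟩ := exists_homeomorph_of_image_eq (f := fun x => χ x 0) (by fun_prop) hg hχi (inj hψ)
    (fun x => by
      rw [← hout x, ← him x]
      refine image_congr fun y hy => ?_
      rw [hχ, hcc (hout x ▸ hy)])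
  refine ⟨fun t => φ + (t : ℝ) • (χ - φ), by fun_prop, ?_, ⟨h, ?_⟩, fun t => ⟨?_, ?_, ?_⟩⟩
  · ext x i
    simp
  · ext x i
    rw [Subsingleton.elim i 0]
    simpa using hh x
  · obtain ⟨S, hS, hcov, hbv⟩ := hφr
    refine ⟨S, hS, hcov, fun γ hγ => ?_⟩
    -- A path stays in one component, where the deformed map is a fixed affine, hence Lipschitz,
    -- function of `φ`.
    let c : ConnectedComponents X := γ 0
    have hγc : ∀ s, (γ s : ConnectedComponents X) = c := fun s =>
      hcc ((isPreconnected_range γ.continuous).subset_connectedComponent ⟨0, rfl⟩ ⟨s, rfl⟩)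
    have hL : LipschitzWith _ fun y : EuclideanSpace ℝ (Fin 1) =>
        (1 - (t : ℝ) + t * α c) • y + ((t : ℝ) * β c) • e :=
      (lipschitzWith_smul (1 - (t : ℝ) + t * α c)).add (LipschitzWith.const _)
    convert hL.comp_boundedVariationOn (hbv γ hγ) using 1
    funext s
    simp only [ContinuousMap.add_apply, ContinuousMap.smul_apply, ContinuousMap.sub_apply,
      ContinuousMap.coe_mk, χ, hγc, Function.comp]
    module
  · refine isTopImmersion_of_injOn (ContinuousMap.continuous _) fun x =>
      ⟨connectedComponent x, isClopen_connectedComponent.isOpen.mem_nhds mem_connectedComponent, ?_⟩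
    intro y hy z hz hyz
    have h0 := congrArg (fun v : EuclideanSpace ℝ (Fin 1) => v 0) hyz
    simp only [ContinuousMap.add_apply, ContinuousMap.smul_apply, ContinuousMap.sub_apply,
      PiLp.add_apply, PiLp.smul_apply, PiLp.sub_apply, smul_eq_mul, hχ, hcc hy, hcc hz] at h0
    have hpos : 0 < 1 - (t : ℝ) + t * α x := by
      rcases t.2.1.eq_or_lt with h | h
      · rw [← h]; norm_num
      · have := mul_pos h (hα x)
        linarith [t.2.2]
    exact inj hφ x hy hz (mul_left_cancel₀ hpos.ne' (by simp only; linarith))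
  · rw [dist_eq_norm, add_sub_cancel_left, norm_smul]
    rw [dist_eq_norm] at hχd
    have : ‖(t : ℝ)‖ ≤ 1 := by
      rw [Real.norm_of_nonneg t.2.1]
      exact t.2.2
    exact (mul_le_of_le_one_left (norm_nonneg _) this).trans_lt hχd

end Line

/-! ### Lipschitz approximation by moving averages. -/

section Smoothing

variable {F : Type*} [NormedAddCommGroup F] [NormedSpace ℝ F]

/-- The average of `f` over the interval from `s` to `s + δ`. -/
noncomputable def movingAverage (f : ℝ → F) (δ s : ℝ) : F := ∫ x in (0 : ℝ)..1, f (s + δ * x)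

/-- The moving average, corrected by an affine function to agree with `f` at `0` and `1`. -/
noncomputable def smoothing (f : ℝ → F) (δ s : ℝ) : F :=
  movingAverage f δ s - (1 - s) • (movingAverage f δ 0 - f 0) - s • (movingAverage f δ 1 - f 1)

theorem continuous_movingAverage {f : ℝ → F} (hf : Continuous f) :
    Continuous fun p : ℝ × ℝ => movingAverage f p.1 p.2 := by
  unfold movingAverage
  refine intervalIntegral.continuous_parametric_intervalIntegral_of_continuous' ?_ 0 1
  exact hf.comp (by fun_prop)

theorem continuous_smoothing {f : ℝ → F} (hf : Continuous f) :
    Continuous fun p : ℝ × ℝ => smoothing f p.1 p.2 := by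
  have h := continuous_movingAverage hf
  have h0 : Continuous fun p : ℝ × ℝ => movingAverage f p.1 0 :=
    h.comp (continuous_fst.prodMk continuous_const)
  have h1 : Continuous fun p : ℝ × ℝ => movingAverage f p.1 1 :=
    h.comp (continuous_fst.prodMk continuous_const)
  unfold smoothing
  fun_prop

theorem smoothing_apply_zero (f : ℝ → F) (δ : ℝ) : smoothing f δ 0 = f 0 := by simp [smoothing]

theorem smoothing_apply_one (f : ℝ → F) (δ : ℝ) : smoothing f δ 1 = f 1 := by simp [smoothing]

theorem smoothing_zero [CompleteSpace F] (f : ℝ → F) (s : ℝ) : smoothing f 0 s = f s := by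
  simp [smoothing, movingAverage]

theorem norm_movingAverage_le {f : ℝ → F} {M : ℝ} (hM : ∀ x, ‖f x‖ ≤ M) (δ s : ℝ) :
    ‖movingAverage f δ s‖ ≤ M := by
  simpa [movingAverage] using intervalIntegral.norm_integral_le_of_norm_le_const (a := (0 : ℝ)) (b := 1)
    (f := fun x => f (s + δ * x)) fun x _ => hM _

/-- Two windows of length `δ` shifted by `|s - s'|` have integrals that differ only by two end
pieces of that length. -/
theorem norm_movingAverage_sub_le {f : ℝ → F} (hf : Continuous f) {M : ℝ} (hM : ∀ x, ‖f x‖ ≤ M)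
    {δ : ℝ} (hδ : 0 < δ) (s s' : ℝ) :
    ‖movingAverage f δ s - movingAverage f δ s'‖ ≤ 2 * M / δ * |s - s'| := by
  have hi : ∀ a b, IntervalIntegrable f MeasureTheory.volume a b := fun a b =>
    hf.intervalIntegrable a b
  have h1 : ∀ s, movingAverage f δ s = δ⁻¹ • ∫ x in s..(s + δ), f x := fun s => by
    simpa [movingAverage] using
      intervalIntegral.integral_comp_add_mul (a := 0) (b := 1) f hδ.ne' s
  have h2 : ∀ a b, ‖∫ x in a..b, f x‖ ≤ M * |b - a| := fun a b =>
    intervalIntegral.norm_integral_le_of_norm_le_const fun x _ => hM x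
  have h3 : movingAverage f δ s - movingAverage f δ s' =
      δ⁻¹ • ((∫ x in s..s', f x) - ∫ x in (s + δ)..(s' + δ), f x) := by
    rw [h1, h1, ← smul_sub,
      intervalIntegral.integral_interval_sub_interval_comm (hi _ _) (hi _ _) (hi _ _)]
  rw [h3, norm_smul, norm_inv, Real.norm_of_nonneg hδ.le]
  have h4 := norm_sub_le (∫ x in s..s', f x) (∫ x in (s + δ)..(s' + δ), f x)
  have h5 := h2 s s'
  have h6 := h2 (s + δ) (s' + δ)
  rw [add_sub_add_right_eq_sub] at h6
  rw [abs_sub_comm] at h5 h6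
  rw [show 2 * M / δ * |s - s'| = δ⁻¹ * (M * |s - s'| + M * |s - s'|) by ring]
  gcongr
  linarith

/-- The average contributes `2M/δ`, the affine correction at most `4M`, which is absorbed into
`4M/δ` because `δ ≤ 1`. -/
theorem norm_smoothing_sub_le {f : ℝ → F} (hf : Continuous f) {M : ℝ} (hM : ∀ x, ‖f x‖ ≤ M)
    {δ : ℝ} (hδ : 0 < δ) (hδ1 : δ ≤ 1) (s s' : ℝ) :
    ‖smoothing f δ s - smoothing f δ s'‖ ≤ 6 * M / δ * |s - s'| := by
  have hM0 : 0 ≤ M := (norm_nonneg _).trans (hM 0)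
  have e : smoothing f δ s - smoothing f δ s' = (movingAverage f δ s - movingAverage f δ s') +
      (s - s') • ((movingAverage f δ 0 - f 0) - (movingAverage f δ 1 - f 1)) := by
    simp only [smoothing]
    module
  have hb : ∀ x, ‖movingAverage f δ x - f x‖ ≤ 2 * M := fun x =>
    (norm_sub_le _ _).trans (by linarith [norm_movingAverage_le hM δ x, hM x])
  have h1 := norm_movingAverage_sub_le hf hM hδ s s'
  have h2 : ‖(s - s') • ((movingAverage f δ 0 - f 0) - (movingAverage f δ 1 - f 1))‖ ≤
      4 * M / δ * |s - s'| := by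
    rw [norm_smul, Real.norm_eq_abs, mul_comm]
    have h3 : ‖(movingAverage f δ 0 - f 0) - (movingAverage f δ 1 - f 1)‖ ≤ 4 * M :=
      (norm_sub_le _ _).trans (by linarith [hb 0, hb 1])
    have h4 : 4 * M ≤ 4 * M / δ := le_div_self (by linarith) hδ hδ1
    gcongr
    linarith
  rw [e]
  refine (norm_add_le _ _).trans ((add_le_add h1 h2).trans (le_of_eq ?_))
  ring

end Smoothing

/-! ### A fast planar curve of small diameter. -/

section Winding

open Complex

/-- A curve of unit speed `N` that first turns with angular velocity `N` and, from the midpoint on,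
turns back. -/
noncomputable def windingVelocity (N s : ℝ) : ℂ := exp (N * Complex.I * (min s (1 - s) : ℝ))

/-- The curve starting at `0` with velocity `N` times `windingVelocity N`. -/
noncomputable def winding (N s : ℝ) : ℂ := N * ∫ x in (0 : ℝ)..s, windingVelocity N x

theorem continuous_windingVelocity : Continuous fun p : ℝ × ℝ => windingVelocity p.1 p.2 := by
  unfold windingVelocity
  fun_prop

theorem continuous_winding : Continuous fun p : ℝ × ℝ => winding p.1 p.2 := by
  unfold winding
  refine (continuous_ofReal.comp continuous_fst).mul ?_
  refine intervalIntegral.continuous_parametric_intervalIntegral_of_continuous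
    (f := fun (p : ℝ × ℝ) x => windingVelocity p.1 x) ?_ continuous_snd
  exact continuous_windingVelocity.comp (by fun_prop : Continuous fun q : (ℝ × ℝ) × ℝ => (q.1.1, q.2))

theorem winding_zero (N : ℝ) : winding N 0 = 0 := by simp [winding]

theorem norm_windingVelocity (N s : ℝ) : ‖windingVelocity N s‖ = 1 := by
  rw [windingVelocity, show (N * Complex.I * (min s (1 - s) : ℝ) : ℂ) = ((N * min s (1 - s) : ℝ) : ℂ) * Complex.I by
    push_cast; ring, norm_exp_ofReal_mul_I]

theorem continuous_windingVelocity_right (N : ℝ) : Continuous (windingVelocity N) :=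
  continuous_windingVelocity.comp (continuous_const.prodMk continuous_id)

theorem hasStrictDerivAt_winding (N s : ℝ) :
    HasStrictDerivAt (winding N) (N * windingVelocity N s) s := by
  have hc := continuous_windingVelocity_right N
  exact (intervalIntegral.integral_hasStrictDerivAt_right (hc.intervalIntegrable _ _)
    hc.aestronglyMeasurable.stronglyMeasurableAtFilter hc.continuousAt).const_mul _

theorem norm_winding_sub_le (N s s' : ℝ) : ‖winding N s - winding N s'‖ ≤ |N| * |s - s'| := by
  have hc := continuous_windingVelocity_right N
  rw [winding, winding, ← mul_sub, intervalIntegral.integral_interval_sub_left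
    (hc.intervalIntegrable _ _) (hc.intervalIntegrable _ _), norm_mul, norm_real, Real.norm_eq_abs]
  gcongr
  simpa using intervalIntegral.norm_integral_le_of_norm_le_const (a := s') (b := s)
    (f := windingVelocity N) fun x _ => (norm_windingVelocity N x).le

theorem norm_mul_integral_exp_le (N a b : ℝ) : ‖(N : ℂ) * ∫ x in a..b, exp (N * Complex.I * x)‖ ≤ 2 := by
  rcases eq_or_ne N 0 with rfl | hN
  · simp
  · have hN' : (N : ℂ) ≠ 0 := ofReal_ne_zero.2 hN
    rw [integral_exp_mul_complex (mul_ne_zero hN' Complex.I_ne_zero), ← mul_div_assoc,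
      mul_div_mul_left _ _ hN', norm_div, norm_I, div_one]
    refine (norm_sub_le _ _).trans ?_
    have h : ∀ x : ℝ, ‖exp (N * Complex.I * x)‖ = 1 := fun x => by
      rw [show (N * Complex.I * x : ℂ) = ((N * x : ℝ) : ℂ) * Complex.I by push_cast; ring, norm_exp_ofReal_mul_I]
    rw [h, h]
    norm_num

/-- Speed and angular velocity are both `N` in size, so each half of the curve runs on a unit circle
and contributes at most the diameter 2, whatever `N` is. Reflecting `x` to `1 - x` reduces the
second half to the same integral. -/
theorem norm_winding_le {N s : ℝ} (hs : s ∈ Icc (0 : ℝ) 1) : ‖winding N s‖ ≤ 4 := by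
  have hc := continuous_windingVelocity_right N
  have left : ∀ {s}, 0 ≤ s → s ≤ 1 / 2 → ‖winding N s‖ ≤ 2 := by
    intro s h0 h1
    have : ∫ x in (0 : ℝ)..s, windingVelocity N x = ∫ x in (0 : ℝ)..s, exp (N * Complex.I * x) := by
      refine intervalIntegral.integral_congr fun x hx => ?_
      rw [uIcc_of_le h0] at hx
      simp only [windingVelocity]
      rw [min_eq_left (by linarith [hx.2])]
    rw [winding, this]
    exact norm_mul_integral_exp_le _ _ _
  rcases le_total s (1 / 2) with h | h
  · exact (left hs.1 h).trans (by norm_num)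
  · have e : ∫ x in (1 / 2 : ℝ)..s, windingVelocity N x =
        ∫ x in (1 - s)..(1 - 1 / 2), exp (N * Complex.I * x) := by
      rw [← intervalIntegral.integral_comp_sub_left (fun x : ℝ => exp (N * Complex.I * x)) 1]
      refine intervalIntegral.integral_congr fun x hx => ?_
      rw [uIcc_of_le h] at hx
      simp only [windingVelocity]
      rw [min_eq_right (by linarith [hx.1])]
    have : winding N s = winding N (1 / 2) + N * ∫ x in (1 / 2 : ℝ)..s, windingVelocity N x := by
      rw [winding, winding, ← mul_add, intervalIntegral.integral_add_adjacent_intervals] <;>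
        exact hc.intervalIntegrable _ _
    rw [this, e]
    refine (norm_add_le _ _).trans ?_
    linarith [left (s := 1 / 2) (by norm_num) le_rfl, norm_mul_integral_exp_le N (1 - s) (1 - 1 / 2)]

/-- A closed curve of size `O(δ)` and speed about `K / δ`. -/
noncomputable def corkscrew (K δ s : ℝ) : ℂ :=
  δ * (winding (K / δ ^ 2) s - s * winding (K / δ ^ 2) 1)

theorem corkscrew_apply_zero (K δ : ℝ) : corkscrew K δ 0 = 0 := by simp [corkscrew, winding_zero]

theorem corkscrew_apply_one (K δ : ℝ) : corkscrew K δ 1 = 0 := by simp [corkscrew]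

theorem corkscrew_zero (K s : ℝ) : corkscrew K 0 s = 0 := by simp [corkscrew]

theorem norm_corkscrew_le (K δ : ℝ) {s : ℝ} (hs : s ∈ Icc (0 : ℝ) 1) :
    ‖corkscrew K δ s‖ ≤ |δ| * 8 := by
  rw [corkscrew, norm_mul, norm_real, Real.norm_eq_abs]
  gcongr
  refine (norm_sub_le _ _).trans ?_
  rw [norm_mul, norm_real, Real.norm_of_nonneg hs.1]
  have h1 := norm_winding_le (N := K / δ ^ 2) hs
  have h2 := norm_winding_le (N := K / δ ^ 2) (right_mem_Icc.2 zero_le_one)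
  nlinarith [mul_le_mul hs.2 h2 (norm_nonneg _) zero_le_one]

/-- At `δ = 0` the frequency `K / δ ^ 2` blows up, but the size bound `8 |δ|` forces convergence to
zero. -/
theorem continuous_corkscrew (K : ℝ) :
    Continuous fun p : ℝ × unitInterval => corkscrew K p.1 p.2 := by
  refine continuous_iff_continuousAt.2 fun ⟨δ, s⟩ => ?_
  rcases eq_or_ne δ 0 with rfl | hδ
  · rw [ContinuousAt, corkscrew_zero]
    refine squeeze_zero_norm (a := fun p : ℝ × unitInterval => |p.1| * 8)
      (fun p => norm_corkscrew_le K p.1 p.2.2) ?_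
    have : Continuous fun p : ℝ × unitInterval => |p.1| * 8 := by fun_prop
    simpa using this.tendsto ((0 : ℝ), s)
  · have h : ContinuousAt (fun p : ℝ × unitInterval => K / p.1 ^ 2) (δ, s) :=
      continuousAt_const.div (by fun_prop) (pow_ne_zero 2 hδ)
    have h1 : ContinuousAt (fun p : ℝ × unitInterval => winding (K / p.1 ^ 2) p.2) (δ, s) :=
      (continuous_winding.continuousAt).comp₂ h (by fun_prop)
    have h2 : ContinuousAt (fun p : ℝ × unitInterval => winding (K / p.1 ^ 2) 1) (δ, s) :=
      (continuous_winding.continuousAt).comp₂ h (by fun_prop)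
    unfold corkscrew
    refine ContinuousAt.mul ?_ (h1.sub (ContinuousAt.mul ?_ h2)) <;>
    exact Continuous.continuousAt (by fun_prop)

theorem norm_corkscrew_sub_le (K : ℝ) {δ : ℝ} (hδ : 0 < δ) (s s' : ℝ) :
    ‖corkscrew K δ s - corkscrew K δ s'‖ ≤ (|K| / δ + 4 * δ) * |s - s'| := by
  have e : corkscrew K δ s - corkscrew K δ s' = δ * ((winding (K / δ ^ 2) s -
      winding (K / δ ^ 2) s') - ((s - s' : ℝ) : ℂ) * winding (K / δ ^ 2) 1) := by
    simp only [corkscrew]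
    push_cast
    ring
  rw [e, norm_mul, norm_real, Real.norm_of_nonneg hδ.le]
  have h1 := norm_winding_sub_le (K / δ ^ 2) s s'
  have h2 := norm_winding_le (N := K / δ ^ 2) (right_mem_Icc.2 zero_le_one)
  rw [abs_div, abs_of_pos (pow_pos hδ 2)] at h1
  have h3 : ‖((s - s' : ℝ) : ℂ) * winding (K / δ ^ 2) 1‖ ≤ |s - s'| * 4 := by
    rw [norm_mul, norm_real, Real.norm_eq_abs]
    gcongr
  have e2 : (|K| / δ + 4 * δ) * |s - s'| = δ * (|K| / δ ^ 2 * |s - s'| + |s - s'| * 4) := by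
    field_simp
  rw [e2]
  gcongr
  exact (norm_sub_le _ _).trans (add_le_add h1 h3)

/-- Near each parameter, the curve is close to a line run at speed `K / δ`. -/
theorem eventually_norm_corkscrew_sub_le {K δ ε : ℝ} (hδ : 0 < δ) (hδ1 : δ ≤ 1) (hε : 0 < ε)
    (s₀ : ℝ) : ∀ᶠ p : ℝ × ℝ in 𝓝 (s₀, s₀), ‖corkscrew K δ p.1 - corkscrew K δ p.2 -
      ((p.1 - p.2) * (K / δ) : ℝ) * windingVelocity (K / δ ^ 2) s₀‖ ≤
        (ε + 4 / δ) * |p.1 - p.2| := by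
  have h := (hasStrictDerivAt_winding (K / δ ^ 2) s₀).isLittleO.def (div_pos hε hδ)
  -- The strict derivative controls pairs of points near `s₀`, as local injectivity requires. The
  -- term `4 / δ` pays for the linear correction that closes the curve.
  filter_upwards [h] with p hp
  have e : corkscrew K δ p.1 - corkscrew K δ p.2 -
      ((p.1 - p.2) * (K / δ) : ℝ) * windingVelocity (K / δ ^ 2) s₀ =
      δ * (winding (K / δ ^ 2) p.1 - winding (K / δ ^ 2) p.2 -
        ((p.1 - p.2 : ℝ) : ℂ) * ((K / δ ^ 2 : ℝ) * windingVelocity (K / δ ^ 2) s₀)) -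
      ((δ * (p.1 - p.2) : ℝ) : ℂ) * winding (K / δ ^ 2) 1 := by
    have hδ' : (δ : ℂ) ≠ 0 := ofReal_ne_zero.2 hδ.ne'
    simp only [corkscrew]
    push_cast
    field_simp
    ring
  have h2 := norm_winding_le (N := K / δ ^ 2) (right_mem_Icc.2 zero_le_one)
  rw [e]
  refine (norm_sub_le _ _).trans ?_
  rw [norm_mul, norm_mul, norm_real, norm_real, Real.norm_of_nonneg hδ.le, norm_mul,
    Real.norm_of_nonneg hδ.le, Real.norm_eq_abs, add_mul]
  refine add_le_add ?_ ?_
  · calc _ ≤ δ * (ε / δ * |p.1 - p.2|) := by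
          gcongr
          simpa using hp
      _ = _ := by field_simp
  · have h4 : δ * 4 ≤ 4 / δ := by
      rw [le_div_iff₀ hδ]
      nlinarith
    calc _ ≤ δ * |p.1 - p.2| * 4 := by gcongr
      _ = δ * 4 * |p.1 - p.2| := by ring
      _ ≤ _ := by gcongr

theorem windingVelocity_apply_zero (N : ℝ) : windingVelocity N 0 = 1 := by simp [windingVelocity]

/-- The purpose of turning back at the midpoint: the final direction does not depend on `N`, so the
directions at the vertices are fixed for all `δ`. -/
theorem windingVelocity_apply_one (N : ℝ) : windingVelocity N 1 = 1 := by simp [windingVelocity]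

end Winding

/-- After squaring, the two sides differ by `(s - t)² (1 + ⟪a, b⟫) / 2`, which is nonnegative. It
keeps points on two different rays apart in proportion to `s + t`. -/
theorem half_add_mul_norm_sub_le {F : Type*} [NormedAddCommGroup F] [InnerProductSpace ℝ F]
    {a b : F} (ha : ‖a‖ = 1) (hb : ‖b‖ = 1) {s t : ℝ} (hs : 0 ≤ s) (ht : 0 ≤ t) :
    (s + t) / 2 * ‖a - b‖ ≤ ‖s • a - t • b‖ := by
  refine le_of_sq_le_sq ?_ (norm_nonneg _)
  have h1 := norm_sub_sq_real a b
  have h2 := norm_sub_sq_real (s • a) (t • b)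
  have h3 := abs_le.1 (abs_real_inner_le_norm a b)
  rw [norm_smul, norm_smul, inner_smul_left, inner_smul_right, Real.norm_of_nonneg hs,
    Real.norm_of_nonneg ht, ha, hb] at h2
  rw [ha, hb] at h1 h3
  simp only [RCLike.conj_to_real] at h2
  rw [mul_pow, h1, h2]
  nlinarith [mul_nonneg (sq_nonneg (s - t)) (by linarith [h3.1] : 0 ≤ 1 + inner ℝ a b)]

/-! ### Local injectivity and families of maps on the graph. -/

namespace Multigraph

variable {V : Type u} {E : Type v} {G : Multigraph V E}

/-- A map is locally injective if it is so in the interior of the edges and if near its vertex each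
half-edge is close to a straight line, in different directions for different half-edges. -/
theorem exists_nhds_injOn [Finite E] {F : Type*} [NormedAddCommGroup F] [InnerProductSpace ℝ F]
    {f : G.Space → F} {c κ : ℝ} (hc : 0 < c) (hκ : κ < 1) {D : E × Bool → F}
    (hD : ∀ h, ‖D h‖ = 1) (hsep : ∀ h h', h ≠ h' → 2 * κ < ‖D h - D h'‖)
    (hend : ∀ h, ∃ ρ > 0, ∀ s t : I, (s : ℝ) < ρ → (t : ℝ) < ρ →
      ‖f (G.halfPt h s) - f (G.halfPt h t) - (((s : ℝ) - t) * c) • D h‖ ≤ κ * c * |(s : ℝ) - t|)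
    (hint : ∀ e (s₀ : I), 0 < (s₀ : ℝ) → (s₀ : ℝ) < 1 → ∃ ρ > 0, ∀ s t : I, |(s : ℝ) - s₀| < ρ →
      |(t : ℝ) - s₀| < ρ → f (G.pt e s) = f (G.pt e t) → s = t) (x : G.Space) :
    ∃ U ∈ 𝓝 x, InjOn f U := by
  rcases exists_vtx_or_pt x with ⟨v, rfl⟩ | ⟨e, s₀, h0, h1, rfl⟩
  · choose ρ hρ hend using hend
    obtain ⟨r, hr, hr1, hrρ⟩ : ∃ r : ℝ, 0 < r ∧ r ≤ 1 ∧ ∀ h, r ≤ ρ h := by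
      have h1 : ∀ᶠ r in 𝓝[>] (0 : ℝ), ∀ h, r ≤ ρ h := Filter.eventually_all.2 fun h =>
        (Filter.eventually_of_mem (Ioc_mem_nhdsGT (hρ h)) fun r hr => hr.2)
      obtain ⟨r, hr, hr1⟩ :=
        (h1.and (Filter.eventually_of_mem (Ioc_mem_nhdsGT one_pos) fun r hr => hr)).exists
      exact ⟨r, hr1.1, hr1.2, hr⟩
    obtain ⟨U, hU, hUs⟩ := exists_nhds_vtx (G := G) v hr hr1
    have line : ∀ h, G.halfVtx h = v → ∀ s : I, (s : ℝ) < r →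
        ‖f (G.halfPt h s) - f (G.vtx v) - ((s : ℝ) * c) • D h‖ ≤ κ * c * s := by
      intro h hh s hs
      have := hend h s 0 (hs.trans_le (hrρ h)) (hρ h)
      rw [halfPt_zero, hh] at this
      simpa [abs_of_nonneg s.2.1] using this
    have apex : ∀ h, G.halfVtx h = v → ∀ s : I, 0 < (s : ℝ) → (s : ℝ) < r →
        f (G.halfPt h s) ≠ f (G.vtx v) := by
      intro h hh s hs hsr heq
      have := line h hh s hsr
      rw [heq, sub_self, zero_sub, norm_neg, norm_smul, hD, mul_one,
        Real.norm_of_nonneg (by positivity)] at this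
      nlinarith [mul_pos hs hc]
    have same : ∀ h (s t : I), (s : ℝ) < r → (t : ℝ) < r → f (G.halfPt h s) = f (G.halfPt h t) →
        s = t := by
      intro h s t hs ht heq
      have := hend h s t (hs.trans_le (hrρ h)) (ht.trans_le (hrρ h))
      rw [heq, sub_self, zero_sub, norm_neg, norm_smul, hD, mul_one, norm_mul,
        Real.norm_of_nonneg hc.le, Real.norm_eq_abs] at this
      by_contra hst
      have h1 : 0 < |(s : ℝ) - t| := abs_pos.2 (sub_ne_zero.2 fun h => hst (Subtype.ext h))
      nlinarith [mul_pos h1 hc]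
    have distinct : ∀ h h', G.halfVtx h = v → G.halfVtx h' = v → h ≠ h' → ∀ s t : I,
        0 < (s : ℝ) → (s : ℝ) < r → (t : ℝ) < r → f (G.halfPt h s) ≠ f (G.halfPt h' t) := by
      intro h h' hh hh' hne s t hs0 hs ht heq
      have h1 := line h hh s hs
      have h2 := line h' hh' t ht
      rw [← heq] at h2
      have h3 := half_add_mul_norm_sub_le (hD h) (hD h') (mul_nonneg s.2.1 hc.le)
        (mul_nonneg t.2.1 hc.le)
      have h4 := norm_sub_le (f (G.halfPt h s) - f (G.vtx v) - ((t : ℝ) * c) • D h')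
        (f (G.halfPt h s) - f (G.vtx v) - ((s : ℝ) * c) • D h)
      rw [sub_sub_sub_cancel_left] at h4
      have h5 : 0 < ((s : ℝ) * c + t * c) / 2 := by
        have := mul_pos hs0 hc
        have := mul_nonneg t.2.1 hc.le
        linarith
      -- The two rays are more than `κ c (s + t)` apart at these parameters, which exceeds the sum
      -- of the two deviations.
      nlinarith [mul_lt_mul_of_pos_left (hsep h h' hne) h5]
    refine ⟨U, hU, fun y hy z hz hyz => ?_⟩
    rcases hUs y hy with rfl | ⟨h, hh, s, hs0, hs, rfl⟩ <;>
      rcases hUs z hz with rfl | ⟨h', hh', t, ht0, ht, rfl⟩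
    · rfl
    · exact absurd hyz.symm (apex h' hh' t ht0 ht)
    · exact absurd hyz (apex h hh s hs0 hs)
    · by_cases hne : h = h'
      · subst hne
        rw [same h s t hs ht hyz]
      · exact absurd hyz (distinct h h' hh hh' hne s t hs0 hs ht)
  · obtain ⟨ρ, hρ, H⟩ := hint e s₀ h0 h1
    obtain ⟨U, hU, hUs⟩ := exists_nhds_pt (G := G) e h0 h1 hρ
    refine ⟨U, hU, fun y hy z hz hyz => ?_⟩
    obtain ⟨s, hs, rfl⟩ := hUs y hy
    obtain ⟨t, ht, rfl⟩ := hUs z hz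
    rw [H s t hs ht hyz]

theorem isRectifiableMap_of_lipschitz [Finite V] [Finite E] {n : ℕ}
    (f : C(G.Space, EuclideanSpace ℝ (Fin n)))
    (h : ∀ e, ∃ C : ℝ, ∀ s t : I, ‖f (G.pt e s) - f (G.pt e t)‖ ≤ C * |(s : ℝ) - t|) :
    IsRectifiableMap f := by
  refine ⟨range (fun v => ContinuousMap.const I (G.vtx v)) ∪
    range (fun e => (⟨G.pt e, G.continuous_pt e⟩ : C(I, G.Space))),
    (finite_range _).union (finite_range _), ?_, ?_⟩
  · refine eq_univ_of_forall fun x => mem_iUnion₂.2 ?_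
    rcases exists_vtx_or_pt x with ⟨v, rfl⟩ | ⟨e, s, -, -, rfl⟩
    · exact ⟨_, .inl ⟨v, rfl⟩, 0, rfl⟩
    · exact ⟨_, .inr ⟨e, rfl⟩, s, rfl⟩
  · rintro _ (⟨v, rfl⟩ | ⟨e, rfl⟩)
    · have : eVariationOn (fun _ : I => f (G.vtx v)) univ = 0 :=
        eVariationOn.constant_on (by simp [Set.Subsingleton])
      simp [BoundedVariationOn, this]
    · obtain ⟨C, hC⟩ := h e
      have hL : LipschitzWith C.toNNReal fun s => f (G.pt e s) := by
        refine LipschitzWith.of_dist_le_mul fun s t => ?_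
        rw [dist_eq_norm, Subtype.dist_eq, Real.dist_eq]
        exact (hC s t).trans (by gcongr; exact Real.le_coe_toNNReal C)
      have hid : BoundedVariationOn (fun s : I => s) univ := by
        have : BoundedVariationOn (fun s : I => (s : ℝ)) univ :=
          MonotoneOn.boundedVariationOn (C := 1) (fun s _ t _ h => h) fun s _ => by
            rw [abs_of_nonneg s.2.1]
            exact s.2.2
        exact this
      exact hL.comp_boundedVariationOn hid

/-- Families of maps that are continuous on each edge form continuous paths of maps. -/
theorem exists_continuousMap_of_continuous_pt {Y : Type*} [TopologicalSpace Y]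
    (F : ℝ → G.Space → Y) (hv : ∀ v, Continuous fun δ => F δ (G.vtx v))
    (he : ∀ e, Continuous fun p : ℝ × I => F p.1 (G.pt e p.2)) :
    ∃ Γ : C(ℝ, C(G.Space, Y)), ∀ δ x, Γ δ x = F δ x := by
  have hx : ∀ x, Continuous fun δ => F δ x := by
    intro x
    rcases exists_vtx_or_pt x with ⟨v, rfl⟩ | ⟨e, s, -, -, rfl⟩
    · exact hv v
    · exact (he e).comp (continuous_id.prodMk continuous_const)
  -- Currying the parameter first reduces continuity on the quotient to single edges; since `ℝ` is
  -- locally compact, uncurrying then gives joint continuity.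
  have hH : Continuous fun x : G.Space => (⟨fun δ => F δ x, hx x⟩ : C(ℝ, Y)) := by
    refine continuous_iff.2 fun e => ?_
    exact (ContinuousMap.curry ⟨fun p : I × ℝ => F p.2 (G.pt e p.1),
      (he e).comp continuous_swap⟩).continuous
  have hj : Continuous fun p : ℝ × G.Space => F p.1 p.2 :=
    (ContinuousMap.uncurry ⟨_, hH⟩).continuous.comp continuous_swap
  exact ⟨ContinuousMap.curry ⟨_, hj⟩, fun _ _ => rfl⟩

/-- The restriction of a map to an edge, as a function of a real parameter. -/
noncomputable def onEdge {Y : Type*} (φ : G.Space → Y) (e : E) (s : ℝ) : Y := φ (G.pt e (projIcc 0 1 zero_le_one s))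

theorem continuous_onEdge {Y : Type*} [TopologicalSpace Y] {φ : G.Space → Y} (hφ : Continuous φ)
    (e : E) : Continuous (onEdge φ e) :=
  hφ.comp ((G.continuous_pt e).comp continuous_projIcc)

theorem onEdge_coe {Y : Type*} (φ : G.Space → Y) (e : E) (s : I) : onEdge φ e s = φ (G.pt e s) := by
  rw [onEdge, projIcc_val]

theorem exists_smoothing {F : Type*} [NormedAddCommGroup F] [NormedSpace ℝ F] [CompleteSpace F]
    (φ : C(G.Space, F)) : ∃ S : C(ℝ, C(G.Space, F)), S 0 = φ ∧
      ∀ δ e (s : I), S δ (G.pt e s) = smoothing (onEdge φ e) δ s := by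
  have h0 : ∀ e, onEdge φ e 0 = φ (G.vtx (G.src e)) := fun e => by
    rw [← pt_zero]
    exact onEdge_coe φ e 0
  have h1 : ∀ e, onEdge φ e 1 = φ (G.vtx (G.tgt e)) := fun e => by
    rw [← pt_one]
    exact onEdge_coe φ e 1
  obtain ⟨S, hS⟩ := exists_continuousMap_of_continuous_pt (G := G)
    (fun δ => lift (fun v => φ (G.vtx v)) (fun e s => smoothing (onEdge φ e) δ s)
      (fun e => by simp [smoothing_apply_zero, h0]) (fun e => by simp [smoothing_apply_one, h1]))
    (fun v => continuous_const)
    (fun e => (continuous_smoothing (continuous_onEdge φ.continuous e)).comp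
      (continuous_fst.prodMk (continuous_subtype_val.comp continuous_snd)))
  refine ⟨S, ?_, fun δ e s => hS _ _⟩
  ext x
  rw [hS]
  rcases exists_vtx_or_pt x with ⟨v, rfl⟩ | ⟨e, s, -, -, rfl⟩
  · rfl
  · exact (smoothing_zero _ _).trans (onEdge_coe _ _ _)

theorem exists_corkscrew {F : Type*} [NormedAddCommGroup F] [NormedSpace ℝ F] (ι : ℂ →ₗᵢ[ℝ] F)
    (K : ℝ) (w : E → ℂ) : ∃ W : C(ℝ, C(G.Space, F)), W 0 = 0 ∧
      ∀ δ e (s : I), W δ (G.pt e s) = ι (w e * corkscrew K δ s) := by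
  obtain ⟨W, hW⟩ := exists_continuousMap_of_continuous_pt (G := G)
    (fun δ => lift (fun _ => (0 : F)) (fun e s => ι (w e * corkscrew K δ s))
      (fun e => by simp [corkscrew_apply_zero]) (fun e => by simp [corkscrew_apply_one]))
    (fun v => continuous_const)
    (fun e => ι.continuous.comp (Continuous.mul (f := fun _ => w e) continuous_const (continuous_corkscrew K)))
  refine ⟨W, ?_, fun δ e s => hW _ _⟩
  ext x
  rw [hW]
  rcases exists_vtx_or_pt x with ⟨v, rfl⟩ | ⟨e, s, -, -, rfl⟩
  · rfl
  · change ι (w e * corkscrew K 0 s) = 0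
    simp [corkscrew_zero]

end Multigraph

/-! ### Directions in a coordinate plane. -/

/-- The complex plane as the first coordinate plane. -/
theorem exists_linearIsometry_complex {n : ℕ} (hn : 2 ≤ n) :
    Nonempty (ℂ →ₗᵢ[ℝ] EuclideanSpace ℝ (Fin n)) := by
  let i : Fin n := ⟨0, by omega⟩
  let j : Fin n := ⟨1, by omega⟩
  have hij : i ≠ j := by simp [i, j]
  refine ⟨⟨Complex.reLm.smulRight (EuclideanSpace.single i (1 : ℝ)) +
    Complex.imLm.smulRight (EuclideanSpace.single j (1 : ℝ)), fun z => ?_⟩⟩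
  refine (sq_eq_sq₀ (norm_nonneg _) (norm_nonneg _)).1 ?_
  have ho : inner ℝ (z.re • EuclideanSpace.single i (1 : ℝ)) (z.im • EuclideanSpace.single j (1 : ℝ))
      = 0 := by
    simp [inner_smul_left, inner_smul_right, EuclideanSpace.inner_single_left, hij]
  have := norm_add_sq_real (z.re • EuclideanSpace.single i (1 : ℝ))
    (z.im • EuclideanSpace.single j (1 : ℝ))
  rw [ho] at this
  simp only [LinearMap.add_apply, LinearMap.smulRight_apply, Complex.reLm_coe, Complex.imLm_coe]
  rw [this, Complex.sq_norm, Complex.normSq_apply]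
  simp [norm_smul]
  ring

/-- Finitely many unit vectors in the plane that span different lines. -/
theorem exists_unit_complex (E : Type*) [Finite E] :
    ∃ w : E → ℂ, (∀ e, ‖w e‖ = 1) ∧ ∀ e e', e ≠ e' → w e ≠ w e' ∧ w e ≠ -w e' := by
  obtain ⟨k, ⟨q⟩⟩ := Finite.exists_equiv_fin E
  -- All real parts are positive, so no two normalised vectors are opposite; the distinct slopes
  -- make them different.
  let z : E → ℂ := fun e => 1 + ((q e : ℕ) : ℝ) * Complex.I
  have hz : ∀ e, (z e).re = 1 := fun e => by simp [z]
  have hz' : ∀ e, (z e).im = (q e : ℕ) := fun e => by simp [z]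
  have hpos : ∀ e, 0 < ‖z e‖ := fun e => norm_pos_iff.2 fun h => by
    have := hz e
    simp [h] at this
  let w : E → ℂ := fun e => ((‖z e‖⁻¹ : ℝ) : ℂ) * z e
  have hre : ∀ e, (w e).re = ‖z e‖⁻¹ := fun e => by simp only [w, Complex.re_ofReal_mul, hz, mul_one]
  have him : ∀ e, (w e).im = ‖z e‖⁻¹ * (q e : ℕ) := fun e => by
    simp only [w, Complex.im_ofReal_mul, hz']
  refine ⟨w, fun e => ?_, fun e e' hee' => ⟨fun h => hee' ?_, fun h => ?_⟩⟩
  · simp only [w, norm_mul, Complex.norm_real, norm_inv, norm_norm]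
    exact inv_mul_cancel₀ (hpos e).ne'
  · have h1 := congrArg Complex.re h
    have h2 := congrArg Complex.im h
    rw [hre, hre] at h1
    rw [him, him, h1] at h2
    have h3 := mul_left_cancel₀ (inv_pos.2 (hpos e')).ne' h2
    exact q.injective (Fin.ext (by exact_mod_cast h3))
  · have h1 := congrArg Complex.re h
    rw [Complex.neg_re, hre, hre] at h1
    have := inv_pos.2 (hpos e)
    have := inv_pos.2 (hpos e')
    linarith

/-! ### Immersions in dimension at least two. -/

namespace Multigraph

variable {V : Type u} {E : Type v} {G : Multigraph V E}

/-- A Lipschitz family of edges becomes a rectifiable immersion when a fast corkscrew in suitable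
directions is added. -/
theorem immersion_of_add_corkscrew [Finite V] [Finite E] {n : ℕ}
    (ι : ℂ →ₗᵢ[ℝ] EuclideanSpace ℝ (Fin n)) {w : E → ℂ} (hw : ∀ e, ‖w e‖ = 1) {κ M δ : ℝ}
    (hκ : 0 < κ) (hκ1 : κ < 1)
    (hsep : ∀ h h' : E × Bool, h ≠ h' →
      2 * κ < ‖ι (if h.2 then -w h.1 else w h.1) - ι (if h'.2 then -w h'.1 else w h'.1)‖)
    (hM : 0 ≤ M) (hδ : 0 < δ) (hδ1 : δ ≤ 1) (f : C(G.Space, EuclideanSpace ℝ (Fin n)))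
    (b : E → ℝ → EuclideanSpace ℝ (Fin n))
    (hb : ∀ e s t, ‖b e s - b e t‖ ≤ M / δ * |s - t|)
    (hf : ∀ e (s : I), f (G.pt e s) = b e s + ι (w e * corkscrew (2 * (M + 4) / κ) δ s)) :
    IsRectifiableMap f ∧ IsTopImmersion f := by
  set K := 2 * (M + 4) / κ with hK
  have hKpos : 0 < K := by positivity
  have hdiff : ∀ e (s t : I), f (G.pt e s) - f (G.pt e t) =
      (b e s - b e t) + ι (w e * (corkscrew K δ s - corkscrew K δ t)) := by
    intro e s t
    rw [hf, hf, mul_sub, map_sub]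
    abel
  refine ⟨isRectifiableMap_of_lipschitz f fun e => ⟨M / δ + (|K| / δ + 4 * δ), fun s t => ?_⟩, ?_⟩
  · rw [hdiff, add_mul]
    refine (norm_add_le _ _).trans (add_le_add (hb e s t) ?_)
    rw [ι.norm_map, norm_mul, hw, one_mul]
    exact norm_corkscrew_sub_le K hδ s t
  have hloc : ∀ e (s₀ : I), ∃ ρ > 0, ∀ s t : I, |(s : ℝ) - s₀| < ρ → |(t : ℝ) - s₀| < ρ →
      ‖f (G.pt e s) - f (G.pt e t) -
        (((s : ℝ) - t) * (K / δ)) • ι (w e * windingVelocity (K / δ ^ 2) s₀)‖ ≤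
          κ * (K / δ) * |(s : ℝ) - t| := by
    intro e s₀
    -- The value of `K` makes `κ K / 2 = M + 4`. The errors `M/δ` from the base map and `4/δ` from
    -- the corkscrew use half of the allowed `κ K / δ`, and this `ε` is the other half.
    have hε : 0 < κ * K / (2 * δ) := by positivity
    obtain ⟨ρ, hρ, H⟩ := Metric.eventually_nhds_iff.1
      (eventually_norm_corkscrew_sub_le (K := K) hδ hδ1 hε (s₀ : ℝ))
    refine ⟨ρ, hρ, fun s t hs ht => ?_⟩
    have h1 := @H ((s : ℝ), (t : ℝ)) (by rw [Prod.dist_eq]; exact max_lt hs ht)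
    simp only at h1
    have e1 : f (G.pt e s) - f (G.pt e t) -
        (((s : ℝ) - t) * (K / δ)) • ι (w e * windingVelocity (K / δ ^ 2) s₀) =
        (b e s - b e t) + ι (w e * (corkscrew K δ s - corkscrew K δ t -
          (((s : ℝ) - t) * (K / δ) : ℝ) * windingVelocity (K / δ ^ 2) s₀)) := by
      rw [hdiff, ← map_smul, add_sub_assoc, ← map_sub]
      congr 2
      rw [Complex.real_smul]
      ring
    rw [e1]
    refine (norm_add_le _ _).trans ((add_le_add (hb e s t) (le_of_eq_of_le ?_ h1)).trans ?_)
    · rw [ι.norm_map, norm_mul, hw, one_mul]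
    · rw [← add_mul]
      refine mul_le_mul_of_nonneg_right (le_of_eq ?_) (abs_nonneg _)
      rw [hK]
      field_simp
      ring
  have hc : 0 < K / δ := by positivity
  refine isTopImmersion_of_injOn f.continuous (exists_nhds_injOn hc hκ1
    (D := fun h => ι (if h.2 then -w h.1 else w h.1)) ?_ hsep ?_ ?_)
  · rintro ⟨e, _ | _⟩ <;> simp [hw]
  · rintro ⟨e, _ | _⟩
    · obtain ⟨ρ, hρ, H⟩ := hloc e 0
      refine ⟨ρ, hρ, fun s t hs ht => ?_⟩
      have := H s t (by simpa [abs_of_nonneg s.2.1] using hs) (by simpa [abs_of_nonneg t.2.1] using ht)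
      simpa [windingVelocity_apply_zero, halfPt] using this
    · obtain ⟨ρ, hρ, H⟩ := hloc e 1
      refine ⟨ρ, hρ, fun s t hs ht => ?_⟩
      have := H (σ s) (σ t) (by simpa [abs_of_nonneg s.2.1] using hs)
        (by simpa [abs_of_nonneg t.2.1] using ht)
      -- The half-edge at the target runs backwards, hence its direction `-w e`.
      have e1 : ((σ s : I) : ℝ) - (σ t : I) = -((s : ℝ) - t) := by simp
      rw [e1] at this
      simpa only [windingVelocity_apply_one, halfPt, Set.Icc.coe_one, mul_one, abs_neg, neg_mul,
        neg_smul, map_neg, smul_neg, if_true] using this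
  · intro e s₀ h0 h1
    obtain ⟨ρ, hρ, H⟩ := hloc e s₀
    refine ⟨ρ, hρ, fun s t hs ht heq => ?_⟩
    have := H s t hs ht
    rw [heq, sub_self, zero_sub, norm_neg, norm_smul, ι.norm_map, norm_mul, norm_mul (w e),
      hw, norm_windingVelocity, mul_one, mul_one, Real.norm_of_nonneg hc.le,
      Real.norm_eq_abs] at this
    by_contra hst
    have h1 : 0 < |(s : ℝ) - t| := abs_pos.2 (sub_ne_zero.2 fun h => hst (Subtype.ext h))
    nlinarith [mul_pos h1 hc]

/-- Directions for the edges such that those of the half-edges are uniformly separated. -/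
theorem exists_directions (E : Type*) [Finite E] {F : Type*} [NormedAddCommGroup F]
    [NormedSpace ℝ F] (ι : ℂ →ₗᵢ[ℝ] F) :
    ∃ (w : E → ℂ) (κ : ℝ), (∀ e, ‖w e‖ = 1) ∧ 0 < κ ∧ κ < 1 ∧ ∀ h h' : E × Bool, h ≠ h' →
      2 * κ < ‖ι (if h.2 then -w h.1 else w h.1) - ι (if h'.2 then -w h'.1 else w h'.1)‖ := by
  obtain ⟨w, hw, hww⟩ := exists_unit_complex E
  have hinj : ∀ h h' : E × Bool, h ≠ h' →
      0 < ‖ι (if h.2 then -w h.1 else w h.1) - ι (if h'.2 then -w h'.1 else w h'.1)‖ := by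
    intro h h' hne
    refine norm_pos_iff.2 (sub_ne_zero.2 (ι.injective.ne ?_))
    obtain ⟨e, b⟩ := h
    obtain ⟨e', b'⟩ := h'
    by_cases he : e = e'
    · subst he
      have h0 : w e ≠ 0 := fun h => by simpa [h] using hw e
      have h1 : w e ≠ -w e := fun h => h0 (self_eq_neg.1 h)
      rcases b with _ | _ <;> rcases b' with _ | _ <;> simp_all [eq_comm]
    · obtain ⟨h1, h2⟩ := hww e e' he
      rcases b with _ | _ <;> rcases b' with _ | _ <;> simp_all [neg_eq_iff_eq_neg]
  have h1 : ∀ᶠ κ in 𝓝[>] (0 : ℝ), ∀ h h' : E × Bool, h ≠ h' → 2 * κ <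
      ‖ι (if h.2 then -w h.1 else w h.1) - ι (if h'.2 then -w h'.1 else w h'.1)‖ := by
    refine Filter.eventually_all.2 fun h => Filter.eventually_all.2 fun h' => ?_
    by_cases hne : h = h'
    · exact Filter.Eventually.of_forall fun κ hne' => absurd hne hne'
    · filter_upwards [Ioo_mem_nhdsGT (half_pos (hinj h h' hne))] with κ hκ _
      linarith [hκ.2]
  obtain ⟨κ, h, h'⟩ := (h1.and (Ioo_mem_nhdsGT (one_pos (α := ℝ)))).exists
  exact ⟨w, κ, hw, h'.1, h'.2, h⟩

/-- Any two continuous maps of a graph to a space of dimension at least two are joined by a path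
that stays close to the first one and runs in between through rectifiable immersions. -/
theorem exists_path_immersion [Finite V] [Finite E] {n : ℕ} (hn : 2 ≤ n)
    (φ ψ : C(G.Space, EuclideanSpace ℝ (Fin n))) {r : ℝ} (hr : dist ψ φ < r) :
    ∃ Γ : I → C(G.Space, EuclideanSpace ℝ (Fin n)), Continuous Γ ∧ Γ 0 = φ ∧ Γ 1 = ψ ∧
      (∀ t, dist (Γ t) φ < r) ∧
      ∀ t : I, 0 < (t : ℝ) → (t : ℝ) < 1 → IsRectifiableMap (Γ t) ∧ IsTopImmersion (Γ t) := by
  obtain ⟨ι⟩ := exists_linearIsometry_complex hn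
  obtain ⟨w, κ, hw, hκ, hκ1, hsep⟩ := exists_directions E ι
  let M : ℝ := max ‖φ‖ ‖ψ‖
  have hM : 0 ≤ M := (norm_nonneg φ).trans (le_max_left _ _)
  obtain ⟨S, hS0, hS⟩ := exists_smoothing φ
  obtain ⟨T, hT0, hT⟩ := exists_smoothing ψ
  obtain ⟨W, hW0, hW⟩ := exists_corkscrew (G := G) ι (2 * (6 * M + 4) / κ) w
  obtain ⟨H, hHe⟩ : ∃ H : ℝ → ℝ → C(G.Space, EuclideanSpace ℝ (Fin n)), ∀ δ t,
    H δ t = (1 - t) • S δ + t • T δ + W δ := ⟨_, fun _ _ => rfl⟩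
  have hH : Continuous fun p : ℝ × ℝ => H p.1 p.2 := by
    simp only [hHe]
    fun_prop
  -- At `η = 0` the family is the straight homotopy, which stays within `dist ψ φ < r` of `φ`;
  -- compactness in `t` extends the strict bound to small `η`.
  have hball : ∀ᶠ η in 𝓝 (0 : ℝ), ∀ t ∈ Icc (0 : ℝ) 1, dist (H (η * (t * (1 - t))) t) φ < r := by
    refine isCompact_Icc.eventually_forall_of_forall_eventually fun t ht => ?_
    have hc : Continuous fun p : ℝ × ℝ => dist (H (p.1 * (p.2 * (1 - p.2))) p.2) φ :=
      (hH.comp (by fun_prop : Continuous fun p : ℝ × ℝ => (p.1 * (p.2 * (1 - p.2)), p.2))).dist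
        continuous_const
    refine hc.continuousAt.eventually_lt (continuousAt_const (y := r)) ?_
    have e : H (0 * (t * (1 - t))) t - φ = t • (ψ - φ) := by
      simp only [hHe, zero_mul, hS0, hT0, hW0]
      module
    simp only
    rw [dist_eq_norm, e, norm_smul, Real.norm_of_nonneg ht.1]
    rw [dist_eq_norm] at hr
    exact (mul_le_of_le_one_left (norm_nonneg _) ht.2).trans_lt hr
  obtain ⟨η, hη, hη0, hη1⟩ :=
    ((hball.filter_mono nhdsWithin_le_nhds).and (Ioc_mem_nhdsGT (one_pos (α := ℝ)))).exists
  refine ⟨fun t => H (η * (t * (1 - t))) t, ?_, ?_, ?_, fun t => hη t t.2, fun t ht0 ht1 => ?_⟩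
  · exact hH.comp (by fun_prop : Continuous fun t : I => (η * ((t : ℝ) * (1 - t)), (t : ℝ)))
  · simp [hHe, hS0, hW0]
  · simp [hHe, hT0, hW0]
  have hδ : 0 < η * ((t : ℝ) * (1 - t)) := mul_pos hη0 (mul_pos ht0 (by linarith))
  have hδ1 : η * ((t : ℝ) * (1 - t)) ≤ 1 :=
    mul_le_one₀ hη1 (mul_pos ht0 (by linarith)).le (by nlinarith)
  have hφM : ∀ e x, ‖onEdge φ e x‖ ≤ M := fun e x => (φ.norm_coe_le_norm _).trans (le_max_left _ _)
  have hψM : ∀ e x, ‖onEdge ψ e x‖ ≤ M := fun e x => (ψ.norm_coe_le_norm _).trans (le_max_right _ _)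
  have h6M : 0 ≤ 6 * M := mul_nonneg (by norm_num) hM
  refine immersion_of_add_corkscrew ι hw hκ hκ1 hsep h6M hδ hδ1 _
    (fun e s => (1 - (t : ℝ)) • smoothing (onEdge φ e) (η * (t * (1 - t))) s +
      (t : ℝ) • smoothing (onEdge ψ e) (η * (t * (1 - t))) s) (fun e s s' => ?_) (fun e s => ?_)
  · have h1 := norm_smoothing_sub_le (continuous_onEdge φ.continuous e) (hφM e) hδ hδ1 s s'
    have h2 := norm_smoothing_sub_le (continuous_onEdge ψ.continuous e) (hψM e) hδ hδ1 s s'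
    rw [add_sub_add_comm, ← smul_sub, ← smul_sub]
    refine (norm_add_le _ _).trans ?_
    rw [norm_smul, norm_smul, Real.norm_of_nonneg ht0.le, Real.norm_of_nonneg (by linarith)]
    nlinarith [mul_le_mul_of_nonneg_left h1 (by linarith : 0 ≤ 1 - (t : ℝ)),
      mul_le_mul_of_nonneg_left h2 ht0.le]
  · simp [hHe, hS, hT, hW]

end Multigraph

/-! ### All dimensions together, and passage to classes. -/

/-- Any two rectifiable immersions of a graph are joined, up to a homeomorphism, by a path of
rectifiable immersions that stays close to the first one. -/
theorem exists_path_rectifiable_immersion {V : Type u} {E : Type v} [Finite V] [Finite E]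
    {G : Multigraph V E} {n : ℕ} (φ ψ : C(G.Space, EuclideanSpace ℝ (Fin n)))
    (hφr : IsRectifiableMap φ) (hψr : IsRectifiableMap ψ) (hφ : IsTopImmersion φ)
    (hψ : IsTopImmersion ψ) {r : ℝ} (hr : dist ψ φ < r) :
    ∃ Γ : I → C(G.Space, EuclideanSpace ℝ (Fin n)), Continuous Γ ∧ Γ 0 = φ ∧
      (∃ h : G.Space ≃ₜ G.Space, Γ 1 = ψ.comp (h : C(G.Space, G.Space))) ∧
      ∀ t, IsRectifiableMap (Γ t) ∧ IsTopImmersion (Γ t) ∧ dist (Γ t) φ < r := by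
  rcases Nat.lt_or_ge n 2 with hn | hn
  · interval_cases n
    · refine ⟨fun _ => φ, continuous_const, rfl, ⟨.refl _, ?_⟩, fun _ => ⟨hφr, hφ, ?_⟩⟩
      · ext x i
        exact i.elim0
      · simpa using dist_nonneg.trans_lt hr
    · exact exists_path_immersion_line φ ψ hφr hφ hψ hr
  · obtain ⟨Γ, hΓ, h0, h1, hd, him⟩ := Multigraph.exists_path_immersion hn φ ψ hr
    refine ⟨Γ, hΓ, h0, ⟨.refl _, h1⟩, fun t => ?_⟩
    rcases t.2.1.eq_or_lt with ht | ht
    · obtain rfl : t = 0 := Subtype.ext ht.symm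
      exact ⟨h0 ▸ hφr, h0 ▸ hφ, hd 0⟩
    rcases t.2.2.eq_or_lt with ht' | ht'
    · obtain rfl : t = 1 := Subtype.ext ht'
      exact ⟨h1 ▸ hψr, h1 ▸ hψ, hd 1⟩
    · exact ⟨(him t ht ht').1, (him t ht ht').2, hd t⟩

theorem frechetEDist_le_edist {X : Type*} [TopologicalSpace X] [CompactSpace X] {n : ℕ}
    (φ ψ : C(X, EuclideanSpace ℝ (Fin n))) : frechetEDist φ ψ ≤ edist φ ψ := by
  rw [ContinuousMap.edist_eq_iSup]
  exact iInf_le_of_le (Homeomorph.refl X) le_rfl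

theorem frechetEDist_comp_homeomorph {X : Type*} [TopologicalSpace X] {n : ℕ}
    (φ : C(X, EuclideanSpace ℝ (Fin n))) (h : X ≃ₜ X) :
    frechetEDist (φ.comp (h : C(X, X))) φ = 0 := by
  refine le_antisymm (iInf_le_of_le h ?_) zero_le
  simp

theorem mainTheorem8 {V : Type u} {E : Type v} [Finite V] [Finite E] (G : Multigraph V E) (n : ℕ)
    (c : ImmersionSpace G n) (r : ℝ≥0) (hr : 0 < r) :
    IsPathConnected (Metric.eball c (r : ℝ≥0∞)) := by
  obtain ⟨_, φ, hφ, rfl⟩ := c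
  refine ⟨_, Metric.mem_eball_self (by exact_mod_cast hr), ?_⟩
  rintro ⟨_, ψ, hψ, rfl⟩ hy
  have hy' : frechetEDist ψ.toMap φ.toMap < r := hy
  obtain ⟨h, hh⟩ := iInf_lt_iff.1 hy'
  -- Reparametrising `ψ` turns the Fréchet bound into a uniform one without changing its class.
  let χ := ψ.toMap.comp (h.symm : C(G.Space, G.Space))
  have hχ : dist χ φ.toMap < r := by
    have : edist χ φ.toMap < r := by
      rw [ContinuousMap.edist_eq_iSup]
      refine lt_of_le_of_lt (iSup_le fun x => ?_) hh
      refine le_of_eq_of_le ?_ (le_iSup (fun x => edist (ψ.toMap x) (φ.toMap (h x))) (h.symm x))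
      simp [χ]
    rw [edist_nndist] at this
    exact_mod_cast this
  obtain ⟨Γ, hΓ, h0, ⟨k, h1⟩, him⟩ := exists_path_rectifiable_immersion φ.toMap χ φ.rectifiable
    (ψ.rectifiable.comp_homeomorph h.symm) hφ (hψ.comp_homeomorph ψ.toMap.continuous h.symm) hχ
  let R : I → RectMap G.Space n := fun t => ⟨Γ t, (him t).1⟩
  have hR : Continuous R := by
    refine continuous_iff_continuousAt.2 fun t => EMetric.tendsto_nhds.2 fun ε hε => ?_
    filter_upwards [EMetric.tendsto_nhds.1 (hΓ.tendsto t) ε hε] with s hs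
    exact (frechetEDist_le_edist (Γ s) (Γ t)).trans_lt hs
  let P : I → ImmersionSpace G n := fun t => ⟨SeparationQuotient.mk (R t), R t, (him t).2.1, rfl⟩
  have hP : Continuous P := (SeparationQuotient.continuous_mk.comp hR).subtype_mk _
  refine ⟨⟨⟨P, hP⟩, ?_, ?_⟩, fun t => ?_⟩
  · have : R 0 = φ := by
      cases φ
      simp only [R, h0]
    exact Subtype.ext (congrArg SeparationQuotient.mk this)
  · refine Subtype.ext ((ContMapSpace.mk_eq_mk_iff _ _).2 ?_)
    have : Γ 1 = ψ.toMap.comp ((k.trans h.symm : G.Space ≃ₜ G.Space) : C(G.Space, G.Space)) := h1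
    change frechetEDist (Γ 1) ψ.toMap = 0
    rw [this]
    exact frechetEDist_comp_homeomorph ψ.toMap (k.trans h.symm)
  · change frechetEDist (Γ t) φ.toMap < r
    refine (frechetEDist_le_edist _ _).trans_lt ?_
    rw [edist_nndist]
    exact_mod_cast (him t).2.2
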